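/- Let $(M,\mathcal I)$ be an exterior differential system: $M$ is a smooth manifold and $\mathcal I$ is a homogeneous ideal of smooth differential forms, closed under $\mathrm d$, finitely generated over $C^\infty(M)$ in each degree, with $\mathcal I_0=0$. Let $e\subset T_xM$ be an $n$-dimensional ordinary integral element, i.e. $e\in M^{(1)}$: all forms of $\mathcal I$ vanish on $e$, and near $e$ the space of $n$-dimensional integral elements is cut out smoothly by $n$-forms of $\mathcal I$ and is submersive over $M$. Put $V_e=e\otimes\mathbb C$, $W_e=(T_xM/e)\otimes\mathbb C$ (projective spaces are represented by the underlying vector spaces), and let $A_e=T_eM^{(1)}_x\otimes\mathbb C\subset W_e\otimes V_e^*$ be the tableau: the complexified space of directions in $\mathrm{Hom}(e,T_xM/e)=T_e\mathrm{Gr}_n(T_xM)$ killed by the differentials at $e$ of the equations $\varphi|_E=0$, $\varphi\in\mathcal I_n$. For a hyperplane $e'\subset V_e$ let $H(e')\subset T_xM\otimes\mathbb C$ be its polar space, i.e. the annihilator of all contractions of forms in $\mathcal I_n$ with $n-1$ vectors of $e'$, and let $r(e')=\dim H(e')-\dim e'-1$. Let $\Xi_e=\{[\xi] : 0\neq\xi\in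 V_e^*,\ r(\xi^\perp)>0\}$ be the characteristic variety, of projective dimension $\ell-1$, let $\langle\Xi_e\rangle\subset V_e^*$ be its linear span, of projective dimension $L-1$, and let $X^1_e=\langle\Xi_e\rangle^\perp\subset V_e$. For a coframe (basis) $u=(u^1,\dots,u^n)$ of $V_e^*$ with dual frame $(u_k)$, its characters are $s_k=\dim A_{k-1}-\dim A_k$, where $A_k=\{\pi\in A_e:\pi(u_1)=\dots=\pi(u_k)=0\}$. The coframe is generic if $(s_1,\dots,s_n)$ is lexicographically maximal among all coframes; these maximal values are the Cartan characters. Assume that $\mathcal I$ is involutive at $e$ in the sense that $A_e$ passes Cartan's test: $\dim A_e^{(1)}=\sum_k k\,s_k$ for the Cartan characters $s_k$, where $A_e^{(1)}=(A_e\otimes V_e^*)\cap(W_e\otimes S^2V_e^*)$. Let $u$ be a generic coframe that is adapted in the following sense: $U^*=\langle u^1,\dots,u^\ell\rangle\subset\langle\Xi_e\rangle$; $Y^*=\langle u^{\ell+1},\dots,u^L\rangle\subset\langle\Xi_e\rangle$ contains no point of $\Xi_e$; and $X^*=\langle u^{L+1},\dots,u^n\rangle$ meets $\langle\Xi_e\rangle$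 only in $0$. Let $(w_a)_{1\le a\le r}$ be a basis of $W_e$ (so $r=\dim M-n$) in which $A_e$ is the set of all $\pi=\pi^a_k\,w_a\otimes u^k$ that satisfy the symbol relations $$\pi^a_k=\sum_{\lambda,b}B^{a,\lambda}_{k,b}\,\pi^b_\lambda\qquad(a>s_k),$$ where $B^{a,\lambda}_{k,b}=0$ unless $\lambda<k$, $b\le s_\lambda$ and $a>s_k$. For $\varphi=\varphi_ku^k\in V_e^*$ and $v=v^ku_k\in V_e$ define $B(\varphi)(v)\in\mathrm{End}(W_e)$ by $$B(\varphi)(v)z=\sum_{k}\sum_{a\le s_k}\varphi_k v^k z^a\,w_a+\sum_{k,\lambda,b}\sum_{a>s_k}B^{a,\lambda}_{k,b}\,z^b v^k\varphi_\lambda\,w_a ,$$ and let $$W^1_e(\varphi)=\Big\{z\in W_e:\ z\otimes\varphi+\sum_{\varrho>\ell}J^a_\varrho\,w_a\otimes u^\varrho\in A_e\ \text{for some }J\Big\}.$$ Then for every $v\in V_e$ the following are equivalent: 1. $v\in X^1_e$; 2. $u^i(v)=0$ for all $i=1,\dots,L$; 3. for every $\varphi\in U^*$, $B(\varphi)(v)$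 maps $W^1_e(\varphi)$ into itself, and its restriction to $W^1_e(\varphi)$ is nilpotent (possibly zero). -/

import Mathlib

open scoped TensorProduct Manifold ContDiff Topology

noncomputable section

namespace EDS

/-! ## Multilinear preliminaries -/

/-- The exterior product of two alternating forms. -/
def wedge {T : Type*} [AddCommGroup T] [Module ℝ T] [TopologicalSpace T] {p q : ℕ}
    (α : T [⋀^Fin p]→L[ℝ] ℝ) (β : T [⋀^Fin q]→L[ℝ] ℝ) : T [⋀^Fin (p + q)]→L[ℝ] ℝ :=
  { ((LinearMap.mul' ℝ ℝ).compAlternatingMap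
      (α.toAlternatingMap.domCoprod β.toAlternatingMap)).domDomCongr finSumFinEquiv with
    cont := by
      change Continuous fun v : Fin (p + q) → T => LinearMap.mul' ℝ ℝ
        ((∑ σ : Equiv.Perm.ModSumCongr (Fin p) (Fin q),
          AlternatingMap.domCoprod.summand α.toAlternatingMap β.toAlternatingMap σ)
            (fun i => v (finSumFinEquiv i)))
      simp only [sum_apply, map_sum]
      refine continuous_finsetSum _ fun σ _ => ?_
      induction σ using Quotient.inductionOn' with
      | h σ =>
        have key : ∀ v : Fin (p + q) → T, LinearMap.mul' ℝ ℝ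
            (AlternatingMap.domCoprod.summand α.toAlternatingMap β.toAlternatingMap
              (Quotient.mk'' σ) (fun i => v (finSumFinEquiv i))) =
            ((Equiv.Perm.sign σ : ℤ) : ℝ) *
              (α (fun i => v (finSumFinEquiv (σ (Sum.inl i)))) *
                β (fun i => v (finSumFinEquiv (σ (Sum.inr i))))) := by
          intro v
          rw [AlternatingMap.domCoprod.summand_mk'', Units.smul_def]
          change LinearMap.mul' ℝ ℝ (((Equiv.Perm.sign σ : ℤˣ) : ℤ) •
            (α (fun i => v (finSumFinEquiv (σ (Sum.inl i)))) ⊗ₜ[ℝ]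
              β (fun i => v (finSumFinEquiv (σ (Sum.inr i)))))) = _
          rw [map_zsmul, LinearMap.mul'_apply, zsmul_eq_mul]
        simp only [key]
        refine continuous_const.mul (Continuous.mul ?_ ?_)
        · exact α.cont.comp (by fun_prop)
        · exact β.cont.comp (by fun_prop) }

/-- The complex multilinear extension to `ℂ ⊗ T` of a real alternating form on `T`, written out in
a basis of `T`. -/
def complexify {T : Type*} [AddCommGroup T] [Module ℝ T] [FiniteDimensional ℝ T] {p : ℕ}
    (φ : T [⋀^Fin p]→ₗ[ℝ] ℝ) : MultilinearMap ℂ (fun _ : Fin p => ℂ ⊗[ℝ] T) ℂ :=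
  ∑ f : Fin p → Fin (Module.finrank ℝ T),
    ((φ (fun i => Module.finBasis ℝ T (f i)) : ℝ) : ℂ) •
      (MultilinearMap.mkPiAlgebra ℂ (Fin p) ℂ).compLinearMap
        (fun i => ((Module.finBasis ℝ T).baseChange ℂ).coord (f i))

/-- `complexify φ` extends `φ`; as `ℂ ⊗ T` is spanned over `ℂ` by the vectors `1 ⊗ v`, it is the
unique complex multilinear extension. -/
theorem complexify_one_tmul {T : Type*} [AddCommGroup T] [Module ℝ T] [FiniteDimensional ℝ T]
    {p : ℕ} (φ : T [⋀^Fin p]→ₗ[ℝ] ℝ) (v : Fin p → T) :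
    complexify φ (fun i => (1 : ℂ) ⊗ₜ[ℝ] v i) = ((φ v : ℝ) : ℂ) := by
  conv_rhs => rw [show v = fun i => ∑ j, (Module.finBasis ℝ T).repr (v i) j • Module.finBasis ℝ T j
    from funext fun i => ((Module.finBasis ℝ T).sum_repr (v i)).symm]
  rw [← AlternatingMap.coe_multilinearMap, MultilinearMap.map_sum]
  simp [complexify, MultilinearMap.map_smul_univ, mul_comm]

/-! ## Differential forms and exterior differential systems on a manifold -/

section Forms

variable {m : ℕ} {M : Type*} [TopologicalSpace M] [ChartedSpace (EuclideanSpace ℝ (Fin m)) M]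

instance finiteDimensional_tangentSpace (x : M) :
    FiniteDimensional ℝ (TangentSpace (𝓡 m) x) :=
  inferInstanceAs (FiniteDimensional ℝ (EuclideanSpace ℝ (Fin m)))

variable (m M) in
/-- (Not necessarily smooth) differential `p`-forms on `M`. -/
abbrev DForm (p : ℕ) : Type _ := ∀ x : M, TangentSpace (𝓡 m) x [⋀^Fin p]→L[ℝ] ℝ

/-- The expression of a form in the chart around `x₀`: its pull-back under the inverse chart. -/
def DForm.inChart {p : ℕ} (φ : DForm m M p) (x₀ : M) (y : EuclideanSpace ℝ (Fin m)) :
    EuclideanSpace ℝ (Fin m) [⋀^Fin p]→L[ℝ] ℝ :=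
  (φ ((extChartAt (𝓡 m) x₀).symm y)).compContinuousLinearMap
    (mfderiv (𝓡 m) (𝓡 m) (extChartAt (𝓡 m) x₀).symm y :
      EuclideanSpace ℝ (Fin m) →L[ℝ] TangentSpace (𝓡 m) ((extChartAt (𝓡 m) x₀).symm y))

/-- A form is smooth if all its chart expressions are. -/
def DForm.IsSmooth {p : ℕ} (φ : DForm m M p) : Prop :=
  ∀ x₀ : M, ContDiffOn ℝ ∞ (φ.inChart x₀) (extChartAt (𝓡 m) x₀).target

/-- The exterior derivative, computed at `x` in the chart around `x`. -/
def DForm.d {p : ℕ} (φ : DForm m M p) : DForm m M (p + 1) := fun x =>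
  (extDeriv (φ.inChart x) (extChartAt (𝓡 m) x x)).compContinuousLinearMap
    (mfderiv (𝓡 m) (𝓡 m) (extChartAt (𝓡 m) x) x :
      TangentSpace (𝓡 m) x →L[ℝ] EuclideanSpace ℝ (Fin m))

variable (m M) in
/-- An exterior differential system on `M`: a homogeneous ideal in the algebra of smooth forms,
closed under exterior differentiation, whose part in each degree is a finitely generated module
over the smooth functions, and which has no nonzero forms of degree `0`. -/
structure ExteriorDifferentialSystem where
  /-- the `p`-forms in the ideal -/
  forms : ∀ p : ℕ, Set (DForm m M p)
  isSmooth : ∀ p, ∀ φ ∈ forms p, φ.IsSmooth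
  zero_mem : ∀ p, (0 : DForm m M p) ∈ forms p
  add_mem : ∀ p, ∀ φ ∈ forms p, ∀ ψ ∈ forms p, φ + ψ ∈ forms p
  smul_mem : ∀ p, ∀ f : M → ℝ, ContMDiff (𝓡 m) 𝓘(ℝ, ℝ) ∞ f → ∀ φ ∈ forms p,
    (fun x => f x • φ x) ∈ forms p
  wedge_mem_left : ∀ p q, ∀ α : DForm m M p, α.IsSmooth → ∀ φ ∈ forms q,
    (fun x => wedge (α x) (φ x)) ∈ forms (p + q)
  wedge_mem_right : ∀ p q, ∀ φ ∈ forms p, ∀ α : DForm m M q, α.IsSmooth →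
    (fun x => wedge (φ x) (α x)) ∈ forms (p + q)
  d_mem : ∀ p, ∀ φ ∈ forms p, φ.d ∈ forms (p + 1)
  finitelyGenerated : ∀ p, ∃ (N : ℕ) (g : Fin N → DForm m M p), (∀ j, g j ∈ forms p) ∧
    ∀ φ ∈ forms p, ∃ f : Fin N → M → ℝ, (∀ j, ContMDiff (𝓡 m) 𝓘(ℝ, ℝ) ∞ (f j)) ∧
      φ = fun x => ∑ j, f j x • g j x
  eq_zero_of_degree_zero : ∀ φ ∈ forms 0, φ = 0

end Forms

/-! ## Tableau and characteristic variety of a subspace with respect to a set of `n`-forms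

`T` is a real vector space (a tangent space), `F` a set of alternating `n`-forms on it (the values
of the `n`-forms of the ideal), and `e` a subspace on which the forms vanish. -/

section Pointwise

variable {T : Type*} [AddCommGroup T] [Module ℝ T]

/-- `V_e = e ⊗ ℂ`. Projective spaces are represented by the underlying vector spaces. -/
abbrev V (e : Submodule ℝ T) : Type _ := ℂ ⊗[ℝ] e

/-- `W_e`, the complexified normal space `(T / e) ⊗ ℂ`, so that
`W_e ⊗ V_e^* = Hom(V_e, W_e)` is the complexified tangent space at `e` to the Grassmannian. -/
abbrev W (e : Submodule ℝ T) : Type _ := ℂ ⊗[ℝ] (T ⧸ e)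

/-- The real tableau: the directions `π ∈ Hom(e, T / e)`, the tangent space at `e` to the
Grassmannian, that are annihilated by the differentials at `e` of all the equations `φ|_E = 0`,
`φ ∈ F`, on subspaces `E` near `e`. The direction `π = P mod e` is represented by the curve of
subspaces `{v + t P v : v ∈ e}`. -/
def realTableau {n : ℕ} (F : Set (T [⋀^Fin n]→ₗ[ℝ] ℝ)) (e : Submodule ℝ T) :
    Set (e →ₗ[ℝ] T ⧸ e) :=
  {π | ∃ P : e →ₗ[ℝ] T, e.mkQ ∘ₗ P = π ∧ ∀ φ ∈ F, ∀ v : Fin n → e,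
    HasDerivAt (fun t : ℝ => φ (fun i => (v i : T) + t • P (v i))) 0 0}

/-- The tableau `A_e ⊆ W_e ⊗ V_e^* = Hom(V_e, W_e)`: the complexification of the real tableau. -/
def tableau {n : ℕ} (F : Set (T [⋀^Fin n]→ₗ[ℝ] ℝ)) (e : Submodule ℝ T) :
    Submodule ℂ (V e →ₗ[ℂ] W e) :=
  Submodule.span ℂ ((fun π : e →ₗ[ℝ] T ⧸ e => π.baseChange ℂ) '' realTableau F e)

variable [FiniteDimensional ℝ T]

/-- The polar space `H(e')` of a complex subspace `e'` of `ℂ ⊗ T` (of dimension `n - 1`): the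
vectors annihilated by all polar equations, the contractions of forms in `F` with `n - 1` vectors
of `e'`. -/
def polarSpace {n : ℕ} (F : Set (T [⋀^Fin n]→ₗ[ℝ] ℝ)) (e' : Submodule ℂ (ℂ ⊗[ℝ] T)) :
    Submodule ℂ (ℂ ⊗[ℝ] T) where
  carrier := {v | ∀ φ ∈ F, ∀ a : Fin n → ℂ ⊗[ℝ] T, (∀ j, a j ∈ e') →
    ∀ i, complexify φ (Function.update a i v) = 0}
  add_mem' := by
    intro v v' hv hv' φ hφ a ha i
    rw [MultilinearMap.map_update_add, hv φ hφ a ha i, hv' φ hφ a ha i, add_zero]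
  zero_mem' := by
    intro φ _ a _ i
    exact MultilinearMap.map_update_zero _ _ _
  smul_mem' := by
    intro c v hv φ hφ a ha i
    rw [MultilinearMap.map_update_smul, hv φ hφ a ha i, smul_zero]

/-- The polar rank `r(e') = dim H(e') - dim e' - 1`. -/
def polarRank {n : ℕ} (F : Set (T [⋀^Fin n]→ₗ[ℝ] ℝ)) (e' : Submodule ℂ (ℂ ⊗[ℝ] T)) : ℤ :=
  (Module.finrank ℂ (polarSpace F e') : ℤ) - Module.finrank ℂ e' - 1

/-- The complex characteristic variety `Ξ_e`, as the set of nonzero covectors `ξ ∈ V_e^*` whose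
hyperplane `ξ^⊥ ⊆ e ⊗ ℂ ⊆ T ⊗ ℂ` has positive polar rank. -/
def charVariety {n : ℕ} (F : Set (T [⋀^Fin n]→ₗ[ℝ] ℝ)) (e : Submodule ℝ T) :
    Set (Module.Dual ℂ (V e)) :=
  {ξ | ξ ≠ 0 ∧ 0 < polarRank F ((LinearMap.ker ξ).map (e.subtype.baseChange ℂ))}

end Pointwise

/-! ## Tableaux, coframes and Guillemin's symbol endomorphisms

A coframe `(u^k)` of `V` is given through its dual frame `u = (u_k)`, so `u^k = u.coord k`. All
indices start from `0`; thus the first `j` indices are those with `k < j`. -/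

section Tableaux

variable {V W : Type*} [AddCommGroup V] [Module ℂ V] [AddCommGroup W] [Module ℂ W] {n r : ℕ}

/-- The elements of `Hom(V, W)` whose first `k` columns with respect to `u` vanish. -/
def columnKer (W : Type*) [AddCommGroup W] [Module ℂ W] (u : Module.Basis (Fin n) ℂ V) (k : ℕ) :
    Submodule ℂ (V →ₗ[ℂ] W) where
  carrier := {π | ∀ j : Fin n, (j : ℕ) < k → π (u j) = 0}
  add_mem' := by
    intro π π' h h' j hj
    simp [h j hj, h' j hj]
  zero_mem' := by
    intro j _
    simp
  smul_mem' := by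
    intro c π h j hj
    simp [h j hj]

/-- The character `s_k` of the tableau `A` with respect to the coframe: the number of independent
entries in column `k` once the previous columns are known. -/
def character (A : Submodule ℂ (V →ₗ[ℂ] W)) (u : Module.Basis (Fin n) ℂ V) (k : Fin n) : ℕ :=
  Module.finrank ℂ ↥(A ⊓ columnKer W u k) - Module.finrank ℂ ↥(A ⊓ columnKer W u (k + 1))

/-- A coframe is generic for `A` if its sequence of characters is lexicographically maximal; the
characters of a generic coframe are the Cartan characters of `A`. -/
def IsGeneric (A : Submodule ℂ (V →ₗ[ℂ] W)) (u : Module.Basis (Fin n) ℂ V) : Prop :=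
  ∀ u' : Module.Basis (Fin n) ℂ V, toLex (character A u') ≤ toLex (character A u)

/-- The prolongation `A^(1) = (A ⊗ V^*) ∩ (W ⊗ S²V^*)`. -/
def prolongation (A : Submodule ℂ (V →ₗ[ℂ] W)) : Submodule ℂ (V →ₗ[ℂ] V →ₗ[ℂ] W) where
  carrier := {P | (∀ v, P v ∈ A) ∧ ∀ v v', P v v' = P v' v}
  add_mem' := by
    intro P P' h h'
    refine ⟨fun v => A.add_mem (h.1 v) (h'.1 v), fun v v' => ?_⟩
    simp [h.2 v v', h'.2 v v']
  zero_mem' := ⟨fun _ => A.zero_mem, fun _ _ => rfl⟩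
  smul_mem' := by
    intro c P h
    refine ⟨fun v => A.smul_mem c (h.1 v), fun v v' => ?_⟩
    simp [h.2 v v']

/-- Cartan's test for involutivity, `dim A^(1) = s_1 + 2 s_2 + ⋯ + n s_n` for the Cartan
characters `s_1, …, s_n` (which do not depend on the generic coframe), where `n = dim V`. -/
def IsInvolutive (n : ℕ) (A : Submodule ℂ (V →ₗ[ℂ] W)) : Prop :=
  ∀ u : Module.Basis (Fin n) ℂ V, IsGeneric A u →
    Module.finrank ℂ (prolongation A) = ∑ k : Fin n, ((k : ℕ) + 1) * character A u k

/-- One plus the dimension of a projective variety `Ξ ⊆ ℙ(V^*)` (given as a set of nonzero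
vectors): the smallest codimension of a linear subspace that does not meet `Ξ`. It is `0` for the
empty variety. -/
def projDimSucc (Ξ : Set (Module.Dual ℂ V)) : ℕ :=
  sInf {c | ∃ Λ : Submodule ℂ (Module.Dual ℂ V),
    Module.finrank ℂ Λ + c = Module.finrank ℂ (Module.Dual ℂ V) ∧ ∀ ξ ∈ Ξ, ξ ∉ Λ}

/-- The span of those covectors `u^k` of the coframe with `i ≤ k < j`. -/
def coframeSpan (u : Module.Basis (Fin n) ℂ V) (i j : ℕ) : Submodule ℂ (Module.Dual ℂ V) :=
  Submodule.span ℂ {ξ | ∃ k : Fin n, i ≤ (k : ℕ) ∧ (k : ℕ) < j ∧ ξ = u.coord k}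

/-- The coframe is adapted to the decomposition `V^* = U^* ⊕ Y^* ⊕ X^*`: with
`dim Ξ = ℓ - 1` and `dim ⟨Ξ⟩ = L - 1` (projective dimensions), `U^* = ⟨u^1, …, u^ℓ⟩` lies in `⟨Ξ⟩`,
`Y^* = ⟨u^{ℓ+1}, …, u^L⟩` lies in `⟨Ξ⟩` and does not meet `Ξ`, and `X^* = ⟨u^{L+1}, …, u^n⟩` is
complementary to `⟨Ξ⟩`. -/
structure IsAdapted (Ξ : Set (Module.Dual ℂ V)) (ℓ L : ℕ) (u : Module.Basis (Fin n) ℂ V) :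
    Prop where
  dim_eq : ℓ = projDimSucc Ξ
  span_dim_eq : L = Module.finrank ℂ (Submodule.span ℂ Ξ)
  U_le : coframeSpan u 0 ℓ ≤ Submodule.span ℂ Ξ
  Y_le : coframeSpan u ℓ L ≤ Submodule.span ℂ Ξ
  Y_disjoint : ∀ ξ ∈ Ξ, ξ ∉ coframeSpan u ℓ L
  X_disjoint : Disjoint (Submodule.span ℂ Ξ) (coframeSpan u L n)

/-- The coefficients `B a lam k b = B^{a,λ}_{k,b}` present the tableau `A` in normal form
`π^a_k = ∑ B^{a,λ}_{k,b} π^b_λ` for all `a > s_k`, where `B^{a,λ}_{k,b} = 0` unless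
`λ < k`, `b ≤ s_λ` and `a > s_k` (in indices starting from `1`). Here `π^a_k` are the entries of
`π = π^a_k (w_a ⊗ u^k)` and `s_k` are the characters. -/
structure IsSymbolNormalForm (A : Submodule ℂ (V →ₗ[ℂ] W)) (u : Module.Basis (Fin n) ℂ V)
    (w : Module.Basis (Fin r) ℂ W) (B : Fin r → Fin n → Fin n → Fin r → ℂ) : Prop where
  eq_zero : ∀ (a : Fin r) (lam k : Fin n) (b : Fin r),
    ¬ (lam < k ∧ (b : ℕ) < character A u lam ∧ character A u k ≤ (a : ℕ)) → B a lam k b = 0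
  mem_iff : ∀ π : V →ₗ[ℂ] W, π ∈ A ↔ ∀ (k : Fin n) (a : Fin r), character A u k ≤ (a : ℕ) →
    w.coord a (π (u k)) = ∑ lam, ∑ b, B a lam k b * w.coord b (π (u lam))

/-- Guillemin's symbol endomorphism `B(φ)(v) ∈ End(W)`: it sends `z` to
`∑_{a ≤ s_k} w_a δ^λ_k δ^a_b z^b v^k φ_λ + ∑_{a > s_k} w_a B^{a,λ}_{k,b} z^b v^k φ_λ`. -/
def symbolEnd (A : Submodule ℂ (V →ₗ[ℂ] W)) (u : Module.Basis (Fin n) ℂ V)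
    (w : Module.Basis (Fin r) ℂ W) (B : Fin r → Fin n → Fin n → Fin r → ℂ)
    (φ : Module.Dual ℂ V) (v : V) : W →ₗ[ℂ] W :=
  Matrix.toLin w w (Matrix.of fun (a : Fin r) (b : Fin r) => ∑ k : Fin n, ∑ lam : Fin n,
    (if (a : ℕ) < character A u k then (if lam = k ∧ a = b then 1 else 0) else B a lam k b) *
      u.coord k v * φ (u lam))

/-- `W^1(φ) = {z : z ⊗ φ + J^a_ϱ (w_a ⊗ u^ϱ) ∈ A for some J}`, with `ϱ > ℓ`; here
`J_ϱ = J^a_ϱ w_a ∈ W`. -/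
def guilleminSpace (A : Submodule ℂ (V →ₗ[ℂ] W)) (u : Module.Basis (Fin n) ℂ V) (ℓ : ℕ)
    (φ : Module.Dual ℂ V) : Submodule ℂ W where
  carrier := {z | ∃ J : Fin n → W,
    φ.smulRight z + ∑ ρ ∈ Finset.univ.filter (fun ρ : Fin n => ℓ ≤ (ρ : ℕ)),
      (u.coord ρ).smulRight (J ρ) ∈ A}
  add_mem' := by
    rintro z z' ⟨J, hJ⟩ ⟨J', hJ'⟩
    refine ⟨J + J', ?_⟩
    convert A.add_mem hJ hJ' using 1
    ext v
    simp [Finset.sum_add_distrib]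
    abel
  zero_mem' := by
    refine ⟨0, ?_⟩
    convert A.zero_mem using 1
    ext v
    simp
  smul_mem' := by
    rintro c z ⟨J, hJ⟩
    refine ⟨c • J, ?_⟩
    convert A.smul_mem c hJ using 1
    ext v
    simp [Finset.smul_sum, smul_comm c]

end Tableaux

/-! ## The objects attached to an exterior differential system -/

namespace ExteriorDifferentialSystem

variable {m : ℕ} {M : Type*} [TopologicalSpace M] [ChartedSpace (EuclideanSpace ℝ (Fin m)) M]

/-- `e ⊆ T_xM` is an integral element: all forms of the ideal vanish on it. -/
def IsIntegralElement (I : ExteriorDifferentialSystem m M) (x : M)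
    (e : Submodule ℝ (TangentSpace (𝓡 m) x)) : Prop :=
  ∀ p, ∀ φ ∈ I.forms p, ∀ v : Fin p → TangentSpace (𝓡 m) x, (∀ i, v i ∈ e) → φ x v = 0

/-- `e = ⟨b_1, …, b_n⟩ ⊆ T_xM` is a Kähler-ordinary point of the space of `n`-dimensional integral
elements, at which that space is moreover submersive over `M`. A point `(y, b')` near `(x, b)`
(with the tangent vectors expressed in the chart around `x`) stands for the span of `b'`: near `e`,
the integral elements are cut out by finitely many `n`-forms `g τ` of the ideal, and the
functions `b' ↦ (g τ)_x(b')` have linearly independent differentials at `b`. -/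
def IsOrdinary (I : ExteriorDifferentialSystem m M) (n : ℕ) (x : M)
    (e : Submodule ℝ (TangentSpace (𝓡 m) x)) : Prop :=
  ∃ (b : Module.Basis (Fin n) ℝ e) (q : ℕ) (g : Fin q → DForm m M n),
    (∀ τ, g τ ∈ I.forms n) ∧
    LinearIndependent ℝ (fun τ => (g τ x).toContinuousMultilinearMap.linearDeriv
      (fun i => (b i : TangentSpace (𝓡 m) x))) ∧
    ∀ᶠ z : EuclideanSpace ℝ (Fin m) × (Fin n → EuclideanSpace ℝ (Fin m)) in
      𝓝 (extChartAt (𝓡 m) x x, fun i =>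
        (mfderiv (𝓡 m) (𝓡 m) (extChartAt (𝓡 m) x) x (b i) : EuclideanSpace ℝ (Fin m))),
      (∀ τ, (g τ).inChart x z.1 z.2 = 0) → ∀ φ ∈ I.forms n, φ.inChart x z.1 z.2 = 0

/-- The fibre over `x` of the space of ordinary `n`-dimensional integral elements, of which the
ordinary prolongation `M^(1)` is a connected component. -/
def ordinaryElements (I : ExteriorDifferentialSystem m M) (n : ℕ) (x : M) :
    Set (Submodule ℝ (TangentSpace (𝓡 m) x)) :=
  {e | Module.finrank ℝ e = n ∧ I.IsIntegralElement x e ∧ I.IsOrdinary n x e}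

/-- The values at `x` of the `n`-forms of the ideal. -/
def formsAt (I : ExteriorDifferentialSystem m M) (n : ℕ) (x : M) :
    Set (TangentSpace (𝓡 m) x [⋀^Fin n]→ₗ[ℝ] ℝ) :=
  {α | ∃ φ ∈ I.forms n, α = (φ x).toAlternatingMap}

/-- The tableau `A_e`. At an ordinary `e` the differentials of the defining equations cut out
exactly the tangent space to the fibre of `M^(1)`, so `A_e = T_e M^(1)_x ⊗ ℂ`. -/
def tableau (I : ExteriorDifferentialSystem m M) (n : ℕ) (x : M)
    (e : Submodule ℝ (TangentSpace (𝓡 m) x)) : Submodule ℂ (V e →ₗ[ℂ] W e) :=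
  EDS.tableau (I.formsAt n x) e

/-- The characteristic variety `Ξ_e`. -/
def charVariety (I : ExteriorDifferentialSystem m M) (n : ℕ) (x : M)
    (e : Submodule ℝ (TangentSpace (𝓡 m) x)) : Set (Module.Dual ℂ (V e)) :=
  EDS.charVariety (I.formsAt n x) e

/-- The space `X^1_e = ⟨Ξ_e⟩^⊥ ⊆ V_e`. -/
def X1 (I : ExteriorDifferentialSystem m M) (n : ℕ) (x : M)
    (e : Submodule ℝ (TangentSpace (𝓡 m) x)) : Submodule ℂ (V e) :=
  (Submodule.span ℂ (I.charVariety n x e)).dualCoannihilator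

/-- Involutivity at `e`: the tableau `A_e`, which is the tableau of the prolonged linear Pfaffian
system on `M^(1)`, passes Cartan's test. -/
def IsInvolutiveAt (I : ExteriorDifferentialSystem m M) (n : ℕ) (x : M)
    (e : Submodule ℝ (TangentSpace (𝓡 m) x)) : Prop :=
  IsInvolutive n (I.tableau n x e)

end ExteriorDifferentialSystem

end EDS

end

/-! A covector ξ ≠ 0 is characteristic exactly when the tableau A contains some ξ ⊗ z with z ≠ 0
(`mem_charVariety`), so everything reduces to algebra of a tableau that passes Cartan's test in the
frame u. The characteristic covectors will appear as the joint eigenvalues of the symbol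
endomorphisms on W¹(φ).

The first point is that elements of A are determined by their first ℓ columns
(`inf_columnKer_eq_bot`). Cartan's test makes evaluation at u_p surjective from the prolongation
elements killed by the earlier frame vectors to A_p. If A_{p+1} = 0, inverting this evaluation gives
commuting operators on A_p. A joint eigenvector is a rank-one element over a covector in the span of
the last coframe vectors, which avoids Ξ; hence A_p = 0.

Next, restriction to the first ℓ frame vectors loses nothing, and a dimension count shows that it
identifies the prolongation of A with that of the restricted tableau
(`exists_prolongation_extension`). For z in W¹(φ), with π in A restricting to z ⊗ φ, the tensor z ⊗
φ ⊗ φ therefore lifts to some P in the prolongation. The normal form gives B(φ)(v)z = π(v), and P(v)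
restricts to π(v) ⊗ φ. So W¹(φ) is invariant, and symmetry of P is commutation of the operators
(`symbolEnd_mem_and_comm`).

Finally, each eigenvalue of B(φ)(v) on W¹(φ) is ξ(v) for a joint eigenvector z with ξ ⊗ z in A,
where ξ is zero or characteristic. Conversely, every characteristic ξ arises from its own U*-part φ.
Nilpotency for all φ thus means that v is killed by Ξ, hence by its span ⟨u^1, …, u^L⟩. -/

noncomputable section

namespace EDS

/-! ### Joint eigenvectors, Cartan's inequality, and the equality case of Cartan's test -/

section Algebra

variable {V W : Type*} [AddCommGroup V] [Module ℂ V] [AddCommGroup W] [Module ℂ W] {n r : ℕ}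

/-- A commuting family of endomorphisms has a joint eigenvector in every nonzero invariant
finite-dimensional subspace. -/
theorem exists_joint_eigenvector {ι D : Type*} [AddCommGroup D] [Module ℂ D]
    [FiniteDimensional ℂ D] (β : ι → Module.End ℂ D) (N : Submodule ℂ D) (hN : N ≠ ⊥)
    (hinv : ∀ i, ∀ z ∈ N, β i z ∈ N) (hcomm : ∀ i j, ∀ z ∈ N, β i (β j z) = β j (β i z)) :
    ∃ z ∈ N, z ≠ 0 ∧ ∃ μ : ι → ℂ, ∀ i, β i z = μ i • z := by
  induction hd : Module.finrank ℂ N using Nat.strong_induction_on generalizing N with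
  | _ d ih =>
  -- Either some eigenspace cuts N properly and the induction descends to it, or every eigenspace
  -- that meets N contains N; then each operator is scalar on N and any nonzero vector will do.
  by_cases h : ∃ i μ, N ⊓ (β i).eigenspace μ ≠ ⊥ ∧ N ⊓ (β i).eigenspace μ ≠ N
  · obtain ⟨i, μ, h0, h1⟩ := h
    have hlt : N ⊓ (β i).eigenspace μ < N := lt_of_le_of_ne inf_le_left h1
    obtain ⟨z, hz, hz0, hμ⟩ := ih _ (hd ▸ Submodule.finrank_lt_finrank_of_lt hlt) _ h0
      (fun j z hz => ⟨hinv j z hz.1, by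
        have := hz.2
        rw [SetLike.mem_coe, Module.End.mem_eigenspace_iff] at this ⊢
        rw [hcomm _ _ _ hz.1, this, map_smul]⟩)
      (fun j k z hz => hcomm j k z hz.1) rfl
    exact ⟨z, hz.1, hz0, hμ⟩
  · push Not at h
    obtain ⟨z, hz, hz0⟩ := Submodule.exists_mem_ne_zero_of_ne_bot hN
    have : Nontrivial N := Submodule.nontrivial_iff_ne_bot.2 hN
    have key : ∀ i, ∃ μ : ℂ, β i z = μ • z := by
      intro i
      obtain ⟨μ, hμ⟩ := Module.End.exists_eigenvalue ((β i).restrict (hinv i))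
      obtain ⟨y, hy⟩ := hμ.exists_hasEigenvector
      have hy1 := hy.apply_eq_smul
      have hne : N ⊓ (β i).eigenspace μ ≠ ⊥ := by
        refine (Submodule.ne_bot_iff _).2 ⟨y, ⟨y.2, ?_⟩, by simpa using hy.2⟩
        rw [SetLike.mem_coe, Module.End.mem_eigenspace_iff]
        simpa using congrArg Subtype.val hy1
      have hz' : z ∈ N ⊓ (β i).eigenspace μ := (h i μ hne).symm ▸ hz
      exact ⟨μ, Module.End.mem_eigenspace_iff.1 hz'.2⟩
    choose μ hμ using key
    exact ⟨z, hz, hz0, μ, hμ⟩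

theorem finrank_eq_finrank_map_add_finrank_inf_ker [FiniteDimensional ℂ V] (f : V →ₗ[ℂ] W)
    (Q : Submodule ℂ V) : Module.finrank ℂ Q =
      Module.finrank ℂ (Q.map f) + Module.finrank ℂ ↥(Q ⊓ LinearMap.ker f) := by
  rw [← LinearMap.range_domRestrict, ← LinearMap.finrank_range_add_finrank_ker (f.domRestrict Q),
    ← Submodule.finrank_map_subtype_eq, LinearMap.ker_domRestrict, Submodule.map_comap_subtype]

/-- Joint eigenvalues arrive as a bare function μ of v. Composing π with a functional that does not
vanish at z shows that μ is linear. -/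
theorem exists_eq_smulRight {π : V →ₗ[ℂ] W} {z : W} (hz : z ≠ 0) {μ : V → ℂ}
    (h : ∀ v, π v = μ v • z) : ∃ ξ : Module.Dual ℂ V, π = ξ.smulRight z ∧ ∀ v, ξ v = μ v := by
  obtain ⟨f, hf⟩ : ∃ f : Module.Dual ℂ W, f z ≠ 0 := by
    by_contra! h0
    exact hz ((Module.forall_dual_apply_eq_zero_iff ℂ z).1 h0)
  have hξ : ∀ v, ((f z)⁻¹ • (f ∘ₗ π)) v = μ v := fun v => by
    rw [LinearMap.smul_apply, LinearMap.comp_apply, h, map_smul, smul_eq_mul, smul_eq_mul]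
    field_simp
  exact ⟨_, LinearMap.ext fun v => by rw [LinearMap.smulRight_apply, hξ, h], hξ⟩

theorem columnKer_antitone (u : Module.Basis (Fin n) ℂ V) : Antitone (columnKer W u) :=
  fun _ _ h _ hπ j hj => hπ j (hj.trans_le h)

theorem columnKer_eq_bot (u : Module.Basis (Fin n) ℂ V) {k : ℕ} (hk : n ≤ k) :
    columnKer W u k = ⊥ := by
  refine (Submodule.eq_bot_iff _).2 fun π hπ => u.ext fun j => ?_
  simpa using hπ j (j.2.trans_le hk)

/-- The elements of the prolongation that are killed by the first `k` vectors of the frame. -/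
def prolongationKer (A : Submodule ℂ (V →ₗ[ℂ] W)) (u : Module.Basis (Fin n) ℂ V) (k : ℕ) :
    Submodule ℂ (V →ₗ[ℂ] V →ₗ[ℂ] W) :=
  prolongation A ⊓ columnKer (V →ₗ[ℂ] W) u k

/-- By symmetry of P, vanishing in the first argument passes to every value P v. -/
theorem apply_mem_of_mem_prolongationKer {A : Submodule ℂ (V →ₗ[ℂ] W)}
    {u : Module.Basis (Fin n) ℂ V} {k : ℕ} {P : V →ₗ[ℂ] V →ₗ[ℂ] W}
    (hP : P ∈ prolongationKer A u k) (v : V) : P v ∈ A ⊓ columnKer W u k :=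
  ⟨hP.1.1 v, fun j hj => by rw [hP.1.2, hP.2 j hj, LinearMap.zero_apply]⟩

theorem prolongationKer_inf_ker (A : Submodule ℂ (V →ₗ[ℂ] W)) (u : Module.Basis (Fin n) ℂ V)
    (k : Fin n) : prolongationKer A u k ⊓ LinearMap.ker (LinearMap.applyₗ (u k)) =
      prolongationKer A u (k + 1) := by
  ext P
  constructor
  · rintro ⟨hP, h0⟩
    refine ⟨hP.1, fun j hj => ?_⟩
    rcases Nat.lt_succ_iff_lt_or_eq.1 hj with h | h
    · exact hP.2 j h
    · obtain rfl : j = k := Fin.ext h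
      exact h0
  · intro hP
    exact ⟨⟨hP.1, columnKer_antitone u (Nat.le_succ _) hP.2⟩, hP.2 k (Nat.lt_succ_self _)⟩

theorem map_prolongationKer_le (A : Submodule ℂ (V →ₗ[ℂ] W)) (u : Module.Basis (Fin n) ℂ V)
    (k : Fin n) :
    (prolongationKer A u k).map (LinearMap.applyₗ (u k)) ≤ A ⊓ columnKer W u k := by
  rintro _ ⟨P, hP, rfl⟩
  exact apply_mem_of_mem_prolongationKer hP (u k)

variable [FiniteDimensional ℂ W]

theorem finiteDimensional_of_frame (u : Module.Basis (Fin n) ℂ V) : FiniteDimensional ℂ V :=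
  u.finiteDimensional_of_finite

theorem finrank_prolongationKer (A : Submodule ℂ (V →ₗ[ℂ] W)) (u : Module.Basis (Fin n) ℂ V)
    (k : Fin n) : Module.finrank ℂ (prolongationKer A u k) =
      Module.finrank ℂ ((prolongationKer A u k).map (LinearMap.applyₗ (u k))) +
        Module.finrank ℂ (prolongationKer A u (k + 1)) := by
  have := finiteDimensional_of_frame u
  rw [← prolongationKer_inf_ker]
  exact finrank_eq_finrank_map_add_finrank_inf_ker _ _

/-- The filtration by `prolongationKer` starts at the whole prolongation and ends at zero;
evaluation at `u k` has the next stage as its kernel, so the ranks telescope. -/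
theorem finrank_prolongation_eq_sum (A : Submodule ℂ (V →ₗ[ℂ] W))
    (u : Module.Basis (Fin n) ℂ V) : Module.finrank ℂ (prolongation A) =
      ∑ k : Fin n, Module.finrank ℂ ((prolongationKer A u k).map (LinearMap.applyₗ (u k))) := by
  have h0 : prolongationKer A u 0 = prolongation A :=
    inf_eq_left.2 fun P _ j hj => absurd hj (Nat.not_lt_zero _)
  have hn : prolongationKer A u n = ⊥ := by
    rw [prolongationKer, columnKer_eq_bot u le_rfl, inf_bot_eq]
  have key : ∀ k : Fin n, (Module.finrank ℂ ((prolongationKer A u k).map (LinearMap.applyₗ (u k))) : ℤ) =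
      -((Module.finrank ℂ (prolongationKer A u (k + 1)) : ℤ) -
        Module.finrank ℂ (prolongationKer A u k)) := fun k => by
    rw [finrank_prolongationKer A u k]; push_cast; ring
  zify
  rw [Finset.sum_congr rfl fun k _ => key k, Finset.sum_neg_distrib,
    Fin.sum_univ_eq_sum_range (fun k => (Module.finrank ℂ (prolongationKer A u (k + 1)) : ℤ) -
        Module.finrank ℂ (prolongationKer A u k)) n,
    Finset.sum_range_sub (fun k => (Module.finrank ℂ (prolongationKer A u k) : ℤ)), h0, hn]
  simp

theorem finrank_map_prolongationKer_le (A : Submodule ℂ (V →ₗ[ℂ] W))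
    (u : Module.Basis (Fin n) ℂ V) (k : Fin n) :
    Module.finrank ℂ ((prolongationKer A u k).map (LinearMap.applyₗ (u k))) ≤
      Module.finrank ℂ ↥(A ⊓ columnKer W u k) := by
  have := finiteDimensional_of_frame u
  exact Submodule.finrank_mono (map_prolongationKer_le A u k)

/-- Cartan's inequality, valid in every frame; no genericity enters. -/
theorem finrank_prolongation_le (A : Submodule ℂ (V →ₗ[ℂ] W)) (u : Module.Basis (Fin n) ℂ V) :
    Module.finrank ℂ (prolongation A) ≤
      ∑ k : Fin n, Module.finrank ℂ ↥(A ⊓ columnKer W u k) := by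
  rw [finrank_prolongation_eq_sum A u]
  exact Finset.sum_le_sum fun k _ => finrank_map_prolongationKer_le A u k

/-- Abel summation turns the right side of Cartan's test into the bound of Cartan's inequality. The
truncated subtraction in `character` is harmless because the stages decrease. -/
theorem sum_mul_character (A : Submodule ℂ (V →ₗ[ℂ] W)) (u : Module.Basis (Fin n) ℂ V) :
    ∑ k : Fin n, ((k : ℕ) + 1) * character A u k =
      ∑ k : Fin n, Module.finrank ℂ ↥(A ⊓ columnKer W u k) := by
  have := finiteDimensional_of_frame u
  set a : ℕ → ℕ := fun k => Module.finrank ℂ ↥(A ⊓ columnKer W u k) with ha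
  have hanti : ∀ k, a (k + 1) ≤ a k := fun k =>
    Submodule.finrank_mono (inf_le_inf_left _ (columnKer_antitone u (Nat.le_succ k)))
  have hn : a n = 0 := by
    simp only [ha]
    rw [columnKer_eq_bot u le_rfl, inf_bot_eq, finrank_bot]
  have key : ∀ N, ∑ k ∈ Finset.range N, (k + 1) * (a k - a (k + 1)) + N * a N =
      ∑ k ∈ Finset.range N, a k := by
    intro N
    induction N with
    | zero => simp
    | succ N ih =>
      rw [Finset.sum_range_succ, Finset.sum_range_succ, ← ih]
      obtain ⟨c, hc⟩ := Nat.exists_eq_add_of_le (hanti N)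
      rw [hc, Nat.add_sub_cancel_left]
      ring
  have h := key n
  rw [hn, mul_zero, add_zero] at h
  rw [Fin.sum_univ_eq_sum_range a n, ← h,
    ← Fin.sum_univ_eq_sum_range (fun k => (k + 1) * (a k - a (k + 1))) n]
  rfl

/-- If Cartan's test holds in the coframe, the polar sequences of the prolongation are exact. -/
theorem exists_prolongationKer_apply_eq {A : Submodule ℂ (V →ₗ[ℂ] W)}
    {u : Module.Basis (Fin n) ℂ V}
    (h : Module.finrank ℂ (prolongation A) = ∑ k : Fin n, ((k : ℕ) + 1) * character A u k)
    (k : Fin n) {π : V →ₗ[ℂ] W} (hπ : π ∈ A ⊓ columnKer W u k) :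
    ∃ P ∈ prolongationKer A u k, P (u k) = π := by
  have := finiteDimensional_of_frame u
  rw [sum_mul_character, finrank_prolongation_eq_sum A u] at h
  -- Equality of the two sums forces equality in each termwise bound.
  have hk := (Finset.sum_eq_sum_iff_of_le
    fun k _ => finrank_map_prolongationKer_le A u k).1 h k (Finset.mem_univ k)
  obtain ⟨P, hP, h⟩ := (Submodule.eq_of_le_of_finrank_eq (map_prolongationKer_le A u k) hk).symm ▸ hπ
  exact ⟨P, hP, h⟩

end Algebra

/-! ### Tableau elements determined by their first columns, and lifts to the prolongation -/

section Algebra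

variable {V W : Type*} [AddCommGroup V] [Module ℂ V] [AddCommGroup W] [Module ℂ W] {n r : ℕ}

theorem mem_coframeSpan {u : Module.Basis (Fin n) ℂ V} {i j : ℕ} {ξ : Module.Dual ℂ V} :
    ξ ∈ coframeSpan u i j ↔ ∀ k : Fin n, ¬ (i ≤ (k : ℕ) ∧ (k : ℕ) < j) → ξ (u k) = 0 := by
  constructor
  · intro h k hk
    induction h using Submodule.span_induction with
    | mem ξ hξ =>
      obtain ⟨k', h1, h2, rfl⟩ := hξ
      rw [u.coord_apply, u.repr_self, Finsupp.single_eq_of_ne]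
      rintro rfl
      exact hk ⟨h1, h2⟩
    | zero => rfl
    | add ξ η _ _ h1 h2 => rw [LinearMap.add_apply, h1, h2, add_zero]
    | smul c ξ _ h1 => rw [LinearMap.smul_apply, h1, smul_zero]
  · intro h
    rw [← u.sum_dual_apply_smul_coord ξ]
    refine Submodule.sum_mem _ fun k _ => ?_
    by_cases hk : i ≤ (k : ℕ) ∧ (k : ℕ) < j
    · exact Submodule.smul_mem _ _ (Submodule.subset_span ⟨k, hk.1, hk.2, rfl⟩)
    · rw [h k hk, zero_smul]
      exact Submodule.zero_mem _

theorem coframeSpan_le_sup (u : Module.Basis (Fin n) ℂ V) (i j k : ℕ) :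
    coframeSpan u i k ≤ coframeSpan u i j ⊔ coframeSpan u j k := by
  refine Submodule.span_le.2 ?_
  rintro _ ⟨a, h1, h2, rfl⟩
  rcases lt_or_ge (a : ℕ) j with h | h
  · exact Submodule.mem_sup_left (Submodule.subset_span ⟨a, h1, h, rfl⟩)
  · exact Submodule.mem_sup_right (Submodule.subset_span ⟨a, h, h2, rfl⟩)

theorem finrank_coframeSpan_zero (u : Module.Basis (Fin n) ℂ V) {j : ℕ} (hj : j ≤ n) :
    Module.finrank ℂ (coframeSpan u 0 j) = j := by
  have h : coframeSpan u 0 j =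
      Submodule.span ℂ (Set.range fun i : Fin j => u.coord (Fin.castLE hj i)) := by
    refine congrArg _ (Set.ext fun ξ => ⟨?_, ?_⟩)
    · rintro ⟨k, _, hk, rfl⟩
      exact ⟨⟨k, hk⟩, rfl⟩
    · rintro ⟨i, rfl⟩
      exact ⟨Fin.castLE hj i, Nat.zero_le _, i.2, rfl⟩
  have hli : LinearIndependent ℂ fun i : Fin j => u.coord (Fin.castLE hj i) := by
    have := u.dualBasis.linearIndependent
    rw [u.coe_dualBasis] at this
    exact this.comp _ (Fin.castLE_injective hj)
  rw [h, finrank_span_eq_card hli, Fintype.card_fin]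

/-- Evaluation of the prolongation on the vector `v`. -/
def prolongationEval (A : Submodule ℂ (V →ₗ[ℂ] W)) (u : Module.Basis (Fin n) ℂ V) (k : ℕ) (v : V) :
    prolongationKer A u k →ₗ[ℂ] ↥(A ⊓ columnKer W u k) where
  toFun P := ⟨P.1 v, apply_mem_of_mem_prolongationKer P.2 v⟩
  map_add' _ _ := rfl
  map_smul' _ _ := rfl

/-- The inclusion of the span of the first `ℓ` vectors of a frame. -/
def frameInclusion (u : Module.Basis (Fin n) ℂ V) {ℓ : ℕ} (hℓ : ℓ ≤ n) : (Fin ℓ → ℂ) →ₗ[ℂ] V :=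
  (Pi.basisFun ℂ (Fin ℓ)).constr ℂ fun i => u (Fin.castLE hℓ i)

theorem frameInclusion_basisFun (u : Module.Basis (Fin n) ℂ V) {ℓ : ℕ} (hℓ : ℓ ≤ n) (i : Fin ℓ) :
    frameInclusion u hℓ (Pi.basisFun ℂ (Fin ℓ) i) = u (Fin.castLE hℓ i) :=
  Module.Basis.constr_basis _ _ _ _

/-- Restriction of bilinear maps. -/
def restrictBilin {U : Type*} [AddCommGroup U] [Module ℂ U] (W : Type*) [AddCommGroup W]
    [Module ℂ W] (f : U →ₗ[ℂ] V) : (V →ₗ[ℂ] V →ₗ[ℂ] W) →ₗ[ℂ] (U →ₗ[ℂ] U →ₗ[ℂ] W) where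
  toFun P := P.compl₁₂ f f
  map_add' _ _ := rfl
  map_smul' _ _ := rfl

theorem eq_zero_of_comp_frameInclusion {A : Submodule ℂ (V →ₗ[ℂ] W)}
    {u : Module.Basis (Fin n) ℂ V} {ℓ : ℕ} (hℓ : ℓ ≤ n) (hbot : A ⊓ columnKer W u ℓ = ⊥)
    {π : V →ₗ[ℂ] W} (hπ : π ∈ A) (h : ∀ x, π (frameInclusion u hℓ x) = 0) : π = 0 := by
  refine (Submodule.eq_bot_iff _).1 hbot π ⟨hπ, fun j hj => ?_⟩
  have := h (Pi.basisFun ℂ (Fin ℓ) ⟨j, hj⟩)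
  rwa [frameInclusion_basisFun] at this

/-- The correction J is arbitrary in the columns from ℓ on, so only the first ℓ columns are
prescribed. -/
theorem mem_guilleminSpace {A : Submodule ℂ (V →ₗ[ℂ] W)} {u : Module.Basis (Fin n) ℂ V} {ℓ : ℕ}
    {φ : Module.Dual ℂ V} {z : W} : z ∈ guilleminSpace A u ℓ φ ↔
      ∃ π ∈ A, ∀ i : Fin n, (i : ℕ) < ℓ → π (u i) = φ (u i) • z := by
  constructor
  · rintro ⟨J, hJ⟩
    refine ⟨_, hJ, fun i hi => ?_⟩
    rw [LinearMap.add_apply, LinearMap.smulRight_apply, LinearMap.sum_apply,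
      Finset.sum_eq_zero, add_zero]
    intro ρ hρ
    have hne : i ≠ ρ := by
      rintro rfl
      exact absurd (Finset.mem_filter.1 hρ).2 (not_le.2 hi)
    rw [LinearMap.smulRight_apply, u.coord_apply, u.repr_self, Finsupp.single_eq_of_ne hne.symm,
      zero_smul]
  · rintro ⟨π, hπ, h⟩
    refine ⟨fun ρ => π (u ρ) - φ (u ρ) • z, ?_⟩
    convert hπ using 1
    refine u.ext fun i => ?_
    rw [LinearMap.add_apply, LinearMap.smulRight_apply, LinearMap.sum_apply]
    simp only [LinearMap.smulRight_apply, u.coord_apply, u.repr_self, Finsupp.single_apply,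
      ite_smul, one_smul, zero_smul]
    rw [Finset.sum_ite_eq]
    by_cases hi : (i : ℕ) < ℓ
    · rw [if_neg (by simpa using hi), h i hi, add_zero]
    · rw [if_pos (by simpa using hi)]
      abel

/-- On the tableau elements that define Guillemin's space, the symbol endomorphism is
evaluation. -/
theorem symbolEnd_apply {A : Submodule ℂ (V →ₗ[ℂ] W)} {u : Module.Basis (Fin n) ℂ V}
    {w : Module.Basis (Fin r) ℂ W} {B : Fin r → Fin n → Fin n → Fin r → ℂ}
    (hB : IsSymbolNormalForm A u w B) {ℓ : ℕ} (hbot : A ⊓ columnKer W u ℓ = ⊥)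
    {φ : Module.Dual ℂ V} {z : W}
    {π : V →ₗ[ℂ] W} (hπ : π ∈ A) (hz : ∀ i : Fin n, (i : ℕ) < ℓ → π (u i) = φ (u i) • z) (v : V) :
    symbolEnd A u w B φ v z = π v := by
  have hchar : ∀ k : Fin n, ℓ ≤ (k : ℕ) → character A u k = 0 := by
    intro k hk
    have : A ⊓ columnKer W u k = ⊥ :=
      le_bot_iff.1 (hbot ▸ inf_le_inf_left _ (columnKer_antitone u hk))
    rw [character, this, finrank_bot, Nat.zero_sub]
  -- From column ℓ on, π may differ from z ⊗ φ, but there the characters vanish and so do the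
  -- coefficients B with that `lam`. Only the shared columns enter the symbol relations.
  have hB' : ∀ a k lam b, B a lam k b * (φ (u lam) * w.coord b z) =
      B a lam k b * w.coord b (π (u lam)) := by
    intro a k lam b
    rcases lt_or_ge (lam : ℕ) ℓ with h | h
    · rw [hz lam h, map_smul, smul_eq_mul]
    · rw [hB.eq_zero a lam k b (by rw [hchar lam h]; simp), zero_mul, zero_mul]
  have hcol : ∀ (k : Fin n) (a : Fin r), ∑ b, (∑ lam, (if (a : ℕ) < character A u k then
      (if lam = k ∧ a = b then 1 else 0) else B a lam k b) * φ (u lam)) * w.coord b z =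
      w.coord a (π (u k)) := by
    intro k a
    by_cases ha : (a : ℕ) < character A u k
    · have hk : (k : ℕ) < ℓ := by
        by_contra h
        rw [hchar k (not_lt.1 h)] at ha
        exact absurd ha (Nat.not_lt_zero _)
      simp only [if_pos ha, ite_and, ite_mul, one_mul, zero_mul, Finset.sum_ite_eq',
        Finset.mem_univ, if_true]
      rw [Finset.sum_ite_eq, if_pos (Finset.mem_univ _), hz k hk, map_smul, smul_eq_mul]
    · simp only [if_neg ha]
      rw [(hB.mem_iff π).1 hπ k a (not_lt.1 ha), Finset.sum_comm]
      refine Finset.sum_congr rfl fun b _ => ?_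
      rw [Finset.sum_mul]
      refine Finset.sum_congr rfl fun lam _ => ?_
      rw [← hB', mul_assoc]
  refine w.ext_elem fun a => ?_
  have hv : π v = ∑ k, u.coord k v • π (u k) := by
    conv_lhs => rw [← u.sum_repr v, map_sum]
    simp
  rw [symbolEnd, Matrix.repr_toLin, hv, map_sum, Finsupp.finsetSum_apply]
  simp only [map_smul, Finsupp.smul_apply, smul_eq_mul, ← w.coord_apply, ← hcol]
  simp only [Matrix.mulVec, dotProduct, Matrix.of_apply, Finset.sum_mul, Finset.mul_sum]
  rw [Finset.sum_comm]
  refine Finset.sum_congr rfl fun k _ => Finset.sum_congr rfl fun b _ =>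
    Finset.sum_congr rfl fun lam _ => ?_
  rw [← w.coord_apply]
  ring

variable [FiniteDimensional ℂ W]

/-- If the polar sequence at step `p` is exact, the next stage of the tableau vanishes and stage
`p` has no elements of rank one, then stage `p` vanishes. -/
theorem inf_columnKer_eq_bot_of_succ {A : Submodule ℂ (V →ₗ[ℂ] W)} {u : Module.Basis (Fin n) ℂ V}
    (p : Fin n)
    (hsurj : ∀ π ∈ A ⊓ columnKer W u p, ∃ P ∈ prolongationKer A u p, P (u p) = π)
    (hsucc : A ⊓ columnKer W u (p + 1) = ⊥)
    (hrank : ∀ ξ ∈ coframeSpan u p n, ∀ z : W, z ≠ 0 → ξ.smulRight z ∈ A → ξ = 0) :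
    A ⊓ columnKer W u p = ⊥ := by
  have := finiteDimensional_of_frame u
  have hinj : ∀ π ∈ A ⊓ columnKer W u p, π (u p) = 0 → π = 0 := by
    intro π hπ h0
    refine (Submodule.eq_bot_iff _).1 hsucc π ⟨hπ.1, fun j hj => ?_⟩
    rcases Nat.lt_succ_iff_lt_or_eq.1 hj with h | h
    · exact hπ.2 j h
    · obtain rfl : j = p := Fin.ext h
      exact h0
  -- A prolongation element killed at `u p` has, by symmetry, all its values killed at `u p`, hence
  -- zero. Surjectivity is exactness of the polar sequence.
  have hbij : Function.Bijective (prolongationEval A u p (u p)) := by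
    refine ⟨(injective_iff_map_eq_zero _).2 fun P hP => ?_, fun π => ?_⟩
    · refine Subtype.ext (LinearMap.ext fun v => ?_)
      refine hinj _ (apply_mem_of_mem_prolongationKer P.2 v) ?_
      rw [P.2.1.2]
      exact congrArg (fun π => π.1 v) hP
    · obtain ⟨P, hP, h⟩ := hsurj π.1 π.2
      exact ⟨⟨P, hP⟩, Subtype.ext h⟩
  set T := LinearEquiv.ofBijective _ hbij
  have hTp : ∀ π : ↥(A ⊓ columnKer W u p), (T.symm π).1 (u p) = π.1 := fun π =>
    congrArg Subtype.val (T.apply_symm_apply π)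
  -- β v sends π to P v, where P is the unique prolongation element of this stage with P (u p) = π.
  set β : V → Module.End ℂ ↥(A ⊓ columnKer W u p) := fun v =>
    prolongationEval A u p v ∘ₗ T.symm.toLinearMap
  have hβp : ∀ v π, (β v π).1 (u p) = π.1 v := fun v π => by
    change (T.symm π).1 v (u p) = _
    rw [(T.symm π).2.1.2, hTp]
  have hcomm : ∀ v v' π, β v (β v' π) = β v' (β v π) := by
    intro v v' π
    -- Elements of this stage are detected at `u p`, where the two composites are P v' v and P v v'
    -- for the same symmetric P.
    refine sub_eq_zero.1 (Subtype.ext (hinj _ (Subtype.property _) ?_))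
    rw [Submodule.coe_sub, LinearMap.sub_apply, hβp, hβp, sub_eq_zero]
    exact (T.symm π).2.1.2 v' v
  by_contra hne
  have : Nontrivial ↥(A ⊓ columnKer W u p) := Submodule.nontrivial_iff_ne_bot.2 hne
  obtain ⟨π, -, hπ0, μ, hμ⟩ := exists_joint_eigenvector β ⊤ top_ne_bot
    (fun _ _ _ => Submodule.mem_top) fun v v' π _ => hcomm v v' π
  have hz : π.1 (u p) ≠ 0 := fun h => hπ0 (Subtype.ext (hinj _ π.2 h))
  have hπv : ∀ v, π.1 v = μ v • π.1 (u p) := fun v => by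
    rw [← hβp, hμ]; rfl
  obtain ⟨ξ, hξ, -⟩ := exists_eq_smulRight hz hπv
  have hξ0 : ξ = 0 := by
    refine hrank ξ (mem_coframeSpan.2 fun k hk => ?_) _ hz (hξ ▸ π.2.1)
    have h0 := π.2.2 k (lt_of_not_ge fun h => hk ⟨h, k.2⟩)
    rw [hξ, LinearMap.smulRight_apply] at h0
    exact (smul_eq_zero.1 h0).resolve_right hz
  exact hπ0 (Subtype.ext (by rw [hξ, hξ0]; simp))

/-- An involutive tableau without elements of rank one that vanish on the first `ℓ` vectors of the
frame has no nonzero elements that vanish there. -/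
theorem inf_columnKer_eq_bot {A : Submodule ℂ (V →ₗ[ℂ] W)} {u : Module.Basis (Fin n) ℂ V}
    (hA : Module.finrank ℂ (prolongation A) = ∑ k : Fin n, ((k : ℕ) + 1) * character A u k)
    {ℓ : ℕ} (hℓ : ℓ ≤ n)
    (hrank : ∀ ξ ∈ coframeSpan u ℓ n, ∀ z : W, z ≠ 0 → ξ.smulRight z ∈ A → ξ = 0) :
    A ⊓ columnKer W u ℓ = ⊥ := by
  -- The induction runs down from stage n, which is zero, and stops at ℓ; the rank-one condition at
  -- ℓ covers every later stage.
  refine Nat.decreasingInduction' (P := fun k => A ⊓ columnKer W u k = ⊥)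
    (fun k hkn hk h => ?_) hℓ ?_
  · refine inf_columnKer_eq_bot_of_succ ⟨k, hkn⟩
      (fun π hπ => exists_prolongationKer_apply_eq hA ⟨k, hkn⟩ hπ) h
      fun ξ hξ => hrank ξ (mem_coframeSpan.2 fun j hj => mem_coframeSpan.1 hξ j ?_)
    exact fun h => hj ⟨hk.trans h.1, h.2⟩
  · rw [columnKer_eq_bot u le_rfl, inf_bot_eq]

/-- If a tableau that passes Cartan's test has no nonzero elements that vanish on the span of the
first `ℓ` vectors of the frame, then every element of the prolongation of its restriction to that
span extends to an element of its prolongation. -/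
theorem exists_prolongation_extension {A : Submodule ℂ (V →ₗ[ℂ] W)} {u : Module.Basis (Fin n) ℂ V}
    (hA : Module.finrank ℂ (prolongation A) = ∑ k : Fin n, ((k : ℕ) + 1) * character A u k)
    {ℓ : ℕ} (hℓ : ℓ ≤ n) (hbot : A ⊓ columnKer W u ℓ = ⊥)
    {Q : (Fin ℓ → ℂ) →ₗ[ℂ] (Fin ℓ → ℂ) →ₗ[ℂ] W}
    (hQ : Q ∈ prolongation (A.map (LinearMap.lcomp ℂ W (frameInclusion u hℓ)))) :
    ∃ P ∈ prolongation A, ∀ x y, P (frameInclusion u hℓ x) (frameInclusion u hℓ y) = Q x y := by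
  have := finiteDimensional_of_frame u
  set f := frameInclusion u hℓ with hf
  set A' := A.map (LinearMap.lcomp ℂ W f) with hA'
  have hle : (prolongation A).map (restrictBilin W f) ≤ prolongation A' := by
    rintro _ ⟨P, hP, rfl⟩
    exact ⟨fun x => ⟨P (f x), hP.1 _, rfl⟩, fun x y => hP.2 _ _⟩
  -- Vanishing on the first ℓ vectors is upgraded twice: first in the values P (f x), then, by
  -- symmetry, in P v for every v.
  have hinj : Function.Injective ((restrictBilin W f).domRestrict (prolongation A)) := by
    refine (injective_iff_map_eq_zero _).2 fun P hP => Subtype.ext ?_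
    have h1 : ∀ x, P.1 (f x) = 0 := fun x =>
      eq_zero_of_comp_frameInclusion hℓ hbot (P.2.1 _) fun y =>
        congrArg (fun Q : (Fin ℓ → ℂ) →ₗ[ℂ] (Fin ℓ → ℂ) →ₗ[ℂ] W => Q x y) hP
    refine LinearMap.ext fun v => eq_zero_of_comp_frameInclusion hℓ hbot (P.2.1 _) fun y => ?_
    rw [P.2.2, ← hf, h1, LinearMap.zero_apply]
  have hcol : ∀ k : Fin ℓ, Module.finrank ℂ ↥(A' ⊓ columnKer W (Pi.basisFun ℂ (Fin ℓ)) k) ≤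
      Module.finrank ℂ ↥(A ⊓ columnKer W u k) := by
    intro k
    have : A' ⊓ columnKer W (Pi.basisFun ℂ (Fin ℓ)) k ≤
        (A ⊓ columnKer W u k).map (LinearMap.lcomp ℂ W f) := by
      rintro _ ⟨⟨π, hπ, rfl⟩, h⟩
      refine ⟨π, ⟨hπ, fun j hj => ?_⟩, rfl⟩
      have := h ⟨j, hj.trans k.2⟩ hj
      rwa [LinearMap.lcomp_apply, hf, frameInclusion_basisFun] at this
    exact (Submodule.finrank_mono this).trans (Submodule.finrank_map_le _ _)
  -- The squeeze: Cartan's inequality for the restriction, then comparison of its stages with those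
  -- of A, then addition of the stages from ℓ to n, which gives dim A^(1) by Cartan's test.
  have hrk : Module.finrank ℂ (prolongation A') ≤
      Module.finrank ℂ ((prolongation A).map (restrictBilin W f)) := by
    rw [← LinearMap.range_domRestrict, LinearMap.finrank_range_of_inj hinj, hA, sum_mul_character]
    refine (finrank_prolongation_le A' (Pi.basisFun ℂ (Fin ℓ))).trans
      ((Finset.sum_le_sum fun k _ => hcol k).trans ?_)
    rw [Fin.sum_univ_eq_sum_range (fun k => Module.finrank ℂ ↥(A ⊓ columnKer W u k)) ℓ,
      Fin.sum_univ_eq_sum_range (fun k => Module.finrank ℂ ↥(A ⊓ columnKer W u k)) n]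
    exact Finset.sum_le_sum_of_subset (Finset.range_subset_range.2 hℓ)
  obtain ⟨P, hP, h⟩ : Q ∈ (prolongation A).map (restrictBilin W f) :=
    (Submodule.eq_of_le_of_finrank_le hle hrk).symm ▸ hQ
  exact ⟨P, hP, fun x y => congrArg (fun Q : (Fin ℓ → ℂ) →ₗ[ℂ] (Fin ℓ → ℂ) →ₗ[ℂ] W => Q x y) h⟩

/-- An element `π` of the tableau that restricts to `z ⊗ φ` on the span of the first `ℓ` vectors
lifts to an element of the prolongation that restricts to `π ⊗ φ`. -/
theorem exists_prolongation_of_restrict_eq {A : Submodule ℂ (V →ₗ[ℂ] W)}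
    {u : Module.Basis (Fin n) ℂ V}
    (hA : Module.finrank ℂ (prolongation A) = ∑ k : Fin n, ((k : ℕ) + 1) * character A u k)
    {ℓ : ℕ} (hℓ : ℓ ≤ n) (hbot : A ⊓ columnKer W u ℓ = ⊥) (φ : Module.Dual ℂ V) (z : W)
    {π : V →ₗ[ℂ] W} (hπ : π ∈ A) (hz : ∀ i : Fin n, (i : ℕ) < ℓ → π (u i) = φ (u i) • z) :
    ∃ P ∈ prolongation A, ∀ i : Fin n, (i : ℕ) < ℓ → P (u i) = φ (u i) • π := by
  set f := frameInclusion u hℓ with hf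
  have hres : π ∘ₗ f = (φ ∘ₗ f).smulRight z := by
    refine (Pi.basisFun ℂ (Fin ℓ)).ext fun i => ?_
    rw [LinearMap.comp_apply, LinearMap.smulRight_apply, LinearMap.comp_apply, hf,
      frameInclusion_basisFun]
    exact hz _ i.2
  -- The symmetric tensor z ⊗ φ ⊗ φ has all its values in multiples of the restriction of π.
  have hQ : (φ ∘ₗ f).smulRight ((φ ∘ₗ f).smulRight z) ∈
      prolongation (A.map (LinearMap.lcomp ℂ W f)) := by
    refine ⟨fun x => ?_, fun x y => ?_⟩
    · rw [LinearMap.smulRight_apply, ← hres]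
      exact Submodule.smul_mem _ _ ⟨π, hπ, rfl⟩
    · simp only [LinearMap.smulRight_apply, LinearMap.smul_apply]
      exact smul_comm _ _ _
  obtain ⟨P, hP, h⟩ := exists_prolongation_extension hA hℓ hbot hQ
  refine ⟨P, hP, fun i hi => sub_eq_zero.1 ?_⟩
  -- P (u i) and φ(u i)π both lie in A and agree on the first ℓ vectors, so they agree everywhere.
  refine eq_zero_of_comp_frameInclusion hℓ hbot
    (A.sub_mem (hP.1 _) (A.smul_mem _ hπ)) fun y => ?_
  have h1 := h (Pi.basisFun ℂ (Fin ℓ) ⟨i, hi⟩) y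
  have h2 := LinearMap.congr_fun hres y
  rw [frameInclusion_basisFun] at h1
  simp only [LinearMap.smulRight_apply, LinearMap.smul_apply, LinearMap.comp_apply] at h1 h2
  rw [LinearMap.sub_apply, LinearMap.smul_apply, ← hf, h2, sub_eq_zero]
  refine h1.trans ?_
  rw [hf, frameInclusion_basisFun]
  rfl

end Algebra

/-! ### Adapted coframes, eigenvalues of symbol endomorphisms, and the theorem for tableaux -/

section Algebra

variable {V W : Type*} [AddCommGroup V] [Module ℂ V] [AddCommGroup W] [Module ℂ W] {n r : ℕ}

/-- Over ℂ the generalized eigenspaces span, so only the one for 0 remains. -/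
theorem isNilpotent_of_eigenvalue_eq_zero [FiniteDimensional ℂ W] (f : Module.End ℂ W)
    (h : ∀ μ, f.HasEigenvalue μ → μ = 0) : IsNilpotent f := by
  have htop : f.maxGenEigenspace 0 = ⊤ := by
    refine top_le_iff.1 (f.iSup_maxGenEigenspace_eq_top ▸ iSup_le fun μ => ?_)
    by_cases hμ : μ = 0
    · rw [hμ]
    · have : f.maxGenEigenspace μ = ⊥ := by
        by_contra hne
        exact hμ (h μ (Module.End.HasUnifEigenvalue.lt zero_lt_one hne))
      rw [this]
      exact bot_le
  refine ⟨Module.finrank ℂ W, LinearMap.ext fun z => ?_⟩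
  have hz : z ∈ f.maxGenEigenspace 0 := htop ▸ Submodule.mem_top
  rw [Module.End.maxGenEigenspace_eq_genEigenspace_finrank, Module.End.mem_genEigenspace_nat,
    zero_smul, sub_zero] at hz
  exact hz

theorem isNilpotent_restrict_of_eigenvalue_eq_zero [FiniteDimensional ℂ W] (f : Module.End ℂ W)
    {G : Submodule ℂ W} (hG : ∀ z ∈ G, f z ∈ G)
    (h : ∀ μ, G ⊓ f.eigenspace μ ≠ ⊥ → μ = 0) : IsNilpotent (f.restrict hG) := by
  refine isNilpotent_of_eigenvalue_eq_zero _ fun μ hμ => h μ ?_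
  obtain ⟨z, hz⟩ := hμ.exists_hasEigenvector
  refine (Submodule.ne_bot_iff _).2 ⟨z, ⟨z.2, ?_⟩, by simpa using hz.2⟩
  exact Module.End.mem_eigenspace_iff.2 (congrArg Subtype.val hz.apply_eq_smul)

theorem IsAdapted.le_card {Ξ : Set (Module.Dual ℂ V)} {ℓ L : ℕ} {u : Module.Basis (Fin n) ℂ V}
    (h : IsAdapted Ξ ℓ L u) (h0 : ∀ ξ ∈ Ξ, ξ ≠ 0) : ℓ ≤ n ∧ L ≤ n := by
  have := u.finiteDimensional_of_finite
  have hn : Module.finrank ℂ (Module.Dual ℂ V) = n := by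
    rw [Subspace.dual_finrank_eq, Module.finrank_eq_card_basis u, Fintype.card_fin]
  constructor
  · rw [h.dim_eq]
    -- The zero subspace misses Ξ and has codimension n, which bounds the infimum.
    exact Nat.sInf_le ⟨⊥, by rw [finrank_bot, zero_add, hn], fun ξ hξ h => h0 ξ hξ (by simpa using h)⟩
  · rw [h.span_dim_eq, ← hn]
    exact Submodule.finrank_le _

theorem IsAdapted.span_eq {Ξ : Set (Module.Dual ℂ V)} {ℓ L : ℕ} {u : Module.Basis (Fin n) ℂ V}
    (h : IsAdapted Ξ ℓ L u) (hL : L ≤ n) : Submodule.span ℂ Ξ = coframeSpan u 0 L := by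
  have := u.finiteDimensional_of_finite
  refine (Submodule.eq_of_le_of_finrank_eq
    ((coframeSpan_le_sup u 0 ℓ L).trans (sup_le h.U_le h.Y_le)) ?_).symm
  rw [finrank_coframeSpan_zero u hL, h.span_dim_eq]

/-- Split ξ into Y* and X* parts. As ξ and Y* lie in ⟨Ξ⟩, so does the X* part, which is then zero;
this leaves ξ in Y*, where there are no points of Ξ. -/
theorem IsAdapted.notMem_coframeSpan {Ξ : Set (Module.Dual ℂ V)} {ℓ L : ℕ}
    {u : Module.Basis (Fin n) ℂ V} (h : IsAdapted Ξ ℓ L u) {ξ : Module.Dual ℂ V} (hξ : ξ ∈ Ξ) :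
    ξ ∉ coframeSpan u ℓ n := by
  intro hmem
  obtain ⟨y, hy, x, hx, rfl⟩ := Submodule.mem_sup.1 (coframeSpan_le_sup u ℓ L n hmem)
  have hx' : x ∈ Submodule.span ℂ Ξ := by
    have := Submodule.sub_mem _ (Submodule.subset_span hξ) (h.Y_le hy)
    rwa [add_sub_cancel_left] at this
  rw [Submodule.disjoint_def.1 h.X_disjoint x hx' hx, add_zero] at hξ
  exact h.Y_disjoint y hξ hy

theorem mem_dualCoannihilator_coframeSpan_zero (u : Module.Basis (Fin n) ℂ V) (L : ℕ) (v : V) :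
    v ∈ (coframeSpan u 0 L).dualCoannihilator ↔ ∀ i : Fin n, (i : ℕ) < L → u.coord i v = 0 := by
  rw [Submodule.mem_dualCoannihilator]
  constructor
  · exact fun h i hi => h _ (Submodule.subset_span ⟨i, Nat.zero_le _, hi, rfl⟩)
  · intro h ξ hξ
    rw [← u.sum_dual_apply_smul_coord ξ, LinearMap.sum_apply]
    refine Finset.sum_eq_zero fun k _ => ?_
    rw [LinearMap.smul_apply, smul_eq_mul]
    rcases lt_or_ge (k : ℕ) L with hk | hk
    · rw [h k hk, mul_zero]
    · rw [mem_coframeSpan.1 hξ k (fun h => absurd h.2 (not_lt.2 hk)), zero_mul]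

/-- Guillemin's theorem: the symbol endomorphisms preserve Guillemin's space and commute there. -/
theorem symbolEnd_mem_and_comm {A : Submodule ℂ (V →ₗ[ℂ] W)} {u : Module.Basis (Fin n) ℂ V}
    (hA : Module.finrank ℂ (prolongation A) = ∑ k : Fin n, ((k : ℕ) + 1) * character A u k)
    {w : Module.Basis (Fin r) ℂ W} {B : Fin r → Fin n → Fin n → Fin r → ℂ}
    (hB : IsSymbolNormalForm A u w B) {ℓ : ℕ} (hℓ : ℓ ≤ n) (hbot : A ⊓ columnKer W u ℓ = ⊥)
    {φ : Module.Dual ℂ V} {z : W} (hz : z ∈ guilleminSpace A u ℓ φ) (v v' : V) :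
    symbolEnd A u w B φ v z ∈ guilleminSpace A u ℓ φ ∧
      symbolEnd A u w B φ v (symbolEnd A u w B φ v' z) =
        symbolEnd A u w B φ v' (symbolEnd A u w B φ v z) := by
  have := w.finiteDimensional_of_finite
  obtain ⟨π, hπ, h⟩ := mem_guilleminSpace.1 hz
  obtain ⟨P, hP, hPu⟩ := exists_prolongation_of_restrict_eq hA hℓ hbot φ z hπ h
  -- P y restricts to π(y) ⊗ φ: it is the witness that π(y) again lies in the Guillemin space, and
  -- it computes the second application of a symbol endomorphism.
  have hPv : ∀ y, ∀ i : Fin n, (i : ℕ) < ℓ → P y (u i) = φ (u i) • π y := fun y i hi => by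
    rw [hP.2, hPu i hi, LinearMap.smul_apply]
  have hs := fun y => symbolEnd_apply hB hbot hπ h y
  refine ⟨mem_guilleminSpace.2 ⟨P v, hP.1 v, by rw [hs]; exact hPv v⟩, ?_⟩
  rw [hs, hs, symbolEnd_apply hB hbot (hP.1 v') (hPv v'), symbolEnd_apply hB hbot (hP.1 v) (hPv v),
    hP.2]

/-- The degeneracy of the characteristic variety of an involutive tableau is detected by the
nilpotency of the symbol endomorphisms. -/
theorem tfae_mem_dualCoannihilator_span {A : Submodule ℂ (V →ₗ[ℂ] W)}
    {u : Module.Basis (Fin n) ℂ V}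
    (hA : Module.finrank ℂ (prolongation A) = ∑ k : Fin n, ((k : ℕ) + 1) * character A u k)
    {w : Module.Basis (Fin r) ℂ W} {B : Fin r → Fin n → Fin n → Fin r → ℂ}
    (hB : IsSymbolNormalForm A u w B) {Ξ : Set (Module.Dual ℂ V)}
    (hΞ : ∀ ξ, ξ ∈ Ξ ↔ ξ ≠ 0 ∧ ∃ z : W, z ≠ 0 ∧ ξ.smulRight z ∈ A) {ℓ L : ℕ}
    (hu : IsAdapted Ξ ℓ L u) (v : V) :
    List.TFAE [
      v ∈ (Submodule.span ℂ Ξ).dualCoannihilator,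
      ∀ i : Fin n, (i : ℕ) < L → u.coord i v = 0,
      ∀ φ ∈ coframeSpan u 0 ℓ,
        ∃ h : ∀ z ∈ guilleminSpace A u ℓ φ,
            symbolEnd A u w B φ v z ∈ guilleminSpace A u ℓ φ,
          IsNilpotent ((symbolEnd A u w B φ v).restrict h)] := by
  have := w.finiteDimensional_of_finite
  obtain ⟨hℓ, hL⟩ := hu.le_card fun ξ hξ => ((hΞ ξ).1 hξ).1
  have hbot : A ⊓ columnKer W u ℓ = ⊥ := by
    refine inf_columnKer_eq_bot hA hℓ fun ξ hξ z hz h => ?_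
    by_contra h0
    exact hu.notMem_coframeSpan ((hΞ ξ).2 ⟨h0, z, hz, h⟩) hξ
  tfae_have 1 ↔ 2 := by
    rw [hu.span_eq hL]
    exact mem_dualCoannihilator_coframeSpan_zero u L v
  tfae_have 1 → 3 := by
    intro hv φ _
    refine ⟨fun z hz => (symbolEnd_mem_and_comm hA hB hℓ hbot hz v v).1, ?_⟩
    refine isNilpotent_restrict_of_eigenvalue_eq_zero _ _ fun μ hμ => ?_
    have hcomm := fun y y' z (hz : z ∈ guilleminSpace A u ℓ φ ⊓
      Module.End.eigenspace (symbolEnd A u w B φ v) μ) =>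
      symbolEnd_mem_and_comm hA hB hℓ hbot hz.1 y y'
    -- Searching inside the μ-eigenspace gives a joint eigenvector whose eigenvalue at v is the
    -- prescribed μ; the tableau element over it then has rank at most one.
    obtain ⟨z, hz, hz0, c, hc⟩ := exists_joint_eigenvector (fun y => symbolEnd A u w B φ y) _ hμ
      (fun y z hz => ⟨(hcomm y y z hz).1, by
        have h := Module.End.mem_eigenspace_iff.1 hz.2
        refine Module.End.mem_eigenspace_iff.2 ?_
        rw [(hcomm v y z hz).2, h, map_smul]⟩) (fun y y' z hz => (hcomm y y' z hz).2)
    obtain ⟨π, hπ, h⟩ := mem_guilleminSpace.1 hz.1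
    obtain ⟨ξ, hξ, hξc⟩ := exists_eq_smulRight hz0 fun y =>
      (symbolEnd_apply hB hbot hπ h y).symm.trans (hc y)
    have hμξ : μ = ξ v := by
      have h1 := Module.End.mem_eigenspace_iff.1 hz.2
      rw [hξc]
      exact smul_left_injective ℂ hz0 (h1.symm.trans (hc v))
    rw [hμξ]
    by_cases hξ0 : ξ = 0
    · rw [hξ0, LinearMap.zero_apply]
    · exact (Submodule.mem_dualCoannihilator _).1 hv ξ
        (Submodule.subset_span ((hΞ ξ).2 ⟨hξ0, z, hz0, hξ ▸ hπ⟩))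
  tfae_have 3 → 1 := by
    intro H
    have hle : Submodule.span ℂ Ξ ≤ LinearMap.ker (Module.Dual.eval ℂ V v) := by
      refine Submodule.span_le.2 fun ξ hξ => ?_
      obtain ⟨hξ0, z, hz, hA'⟩ := (hΞ ξ).1 hξ
      -- φ is the U*-part of ξ, so ξ ⊗ z itself puts z in the Guillemin space of φ and makes it an
      -- eigenvector with eigenvalue ξ(v).
      obtain ⟨φ, hφ, hφξ⟩ : ∃ φ ∈ coframeSpan u 0 ℓ,
          ∀ i : Fin n, (i : ℕ) < ℓ → φ (u i) = ξ (u i) := by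
        refine ⟨u.constr ℂ fun i : Fin n => if (i : ℕ) < ℓ then ξ (u i) else 0,
          mem_coframeSpan.2 fun k hk => ?_, fun i hi => ?_⟩
        · rw [u.constr_basis, if_neg fun h => hk ⟨Nat.zero_le _, h⟩]
        · rw [u.constr_basis, if_pos hi]
      have hres : ∀ i : Fin n, (i : ℕ) < ℓ → ξ.smulRight z (u i) = φ (u i) • z := fun i hi => by
        rw [hφξ i hi, LinearMap.smulRight_apply]
      have hzG : z ∈ guilleminSpace A u ℓ φ := mem_guilleminSpace.2 ⟨_, hA', hres⟩
      obtain ⟨hmem, hnil⟩ := H φ hφ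
      have hev : Module.End.HasEigenvalue ((symbolEnd A u w B φ v).restrict hmem) (ξ v) := by
        refine Module.End.hasEigenvalue_of_hasEigenvector (x := ⟨z, hzG⟩)
          ⟨Module.End.mem_eigenspace_iff.2 (Subtype.ext ?_), fun h => hz (congrArg Subtype.val h)⟩
        exact symbolEnd_apply hB hbot hA' hres v
      exact (hev.isNilpotent_of_isNilpotent hnil).eq_zero
    exact (Submodule.mem_dualCoannihilator _).2 fun ξ hξ => hle hξ
  tfae_finish

end Algebra

/-! ### The tableau as the solution space of complexified linear equations -/

section Pointwise

variable {T : Type*} [AddCommGroup T] [Module ℝ T]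

/-- The polynomial expansion in t has `linearDeriv` as its first-order coefficient; this needs no
topology on E. -/
theorem hasDerivAt_multilinear_line {E : Type*} [AddCommGroup E] [Module ℝ E] {n : ℕ}
    (φ : MultilinearMap ℝ (fun _ : Fin n => E) ℝ) (v h : Fin n → E) :
    HasDerivAt (fun t : ℝ => φ (fun i => v i + t • h i)) (φ.linearDeriv v h) 0 := by
  have hexp : (fun t : ℝ => φ (fun i => v i + t • h i)) = fun t =>
      φ v + t * φ.linearDeriv v h +
        ∑ s : Finset (Fin n) with 2 ≤ s.card, t ^ s.card * φ (s.piecewise h v) := by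
    funext t
    have := φ.map_add_eq_map_add_linearDeriv_add v (t • h)
    rw [map_smul, smul_eq_mul] at this
    refine this.trans (congrArg _ (Finset.sum_congr rfl fun s _ => ?_))
    have h2 := φ.map_piecewise_smul (fun _ => t) (s.piecewise h v) s
    rw [Finset.prod_const, smul_eq_mul] at h2
    rw [← h2]
    congr 1
    funext i
    by_cases hi : i ∈ s <;> simp [hi]
  rw [hexp]
  have h1 : HasDerivAt (fun t : ℝ => φ v + t * φ.linearDeriv v h) (φ.linearDeriv v h) 0 := by
    simpa using ((hasDerivAt_id (0 : ℝ)).mul_const (φ.linearDeriv v h)).const_add (φ v)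
  have h2 : HasDerivAt (fun t : ℝ => ∑ s : Finset (Fin n) with 2 ≤ s.card,
      t ^ s.card * φ (s.piecewise h v)) (∑ s : Finset (Fin n) with 2 ≤ s.card, 0) 0 := by
    refine HasDerivAt.fun_sum fun s hs => ?_
    have hs2 : 2 ≤ s.card := (Finset.mem_filter.1 hs).2
    have := (hasDerivAt_pow s.card (0 : ℝ)).mul_const (φ (s.piecewise h v))
    rwa [zero_pow (by omega), mul_zero, zero_mul] at this
  rw [Finset.sum_const_zero] at h2
  have h3 := h1.fun_add h2
  rwa [add_zero] at h3

theorem exists_splitting (e : Submodule ℝ T) : ∃ (σ : T ⧸ e →ₗ[ℝ] T) (ρ : T →ₗ[ℝ] e),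
    e.mkQ ∘ₗ σ = LinearMap.id ∧ ρ ∘ₗ e.subtype = LinearMap.id ∧
      e.subtype ∘ₗ ρ + σ ∘ₗ e.mkQ = LinearMap.id := by
  obtain ⟨σ, hσ⟩ := e.mkQ.exists_rightInverse_of_surjective e.range_mkQ
  have hmem : ∀ t, (LinearMap.id - σ ∘ₗ e.mkQ : T →ₗ[ℝ] T) t ∈ e := fun t => by
    have := LinearMap.congr_fun hσ (e.mkQ t)
    refine (Submodule.Quotient.mk_eq_zero e).1 ?_
    rw [← e.mkQ_apply, LinearMap.sub_apply, map_sub, sub_eq_zero]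
    exact this.symm
  refine ⟨σ, (LinearMap.id - σ ∘ₗ e.mkQ).codRestrict e hmem, hσ, ?_, ?_⟩
  · refine LinearMap.ext fun t => Subtype.ext ?_
    have h0 : e.mkQ (t : T) = 0 := (Submodule.Quotient.mk_eq_zero e).2 t.2
    simp only [LinearMap.comp_apply, LinearMap.codRestrict_apply, LinearMap.sub_apply,
      Submodule.subtype_apply, LinearMap.id_apply]
    rw [h0, map_zero, sub_zero]
  · refine LinearMap.ext fun t => ?_
    simp only [LinearMap.add_apply, LinearMap.comp_apply, Submodule.subtype_apply,
      LinearMap.codRestrict_apply, LinearMap.sub_apply, LinearMap.id_apply]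
    exact sub_add_cancel _ _

/-- The differential at `e` of the equation `φ|_E = 0`. -/
theorem mem_realTableau {n : ℕ} {F : Set (T [⋀^Fin n]→ₗ[ℝ] ℝ)} {e : Submodule ℝ T}
    (hF : ∀ φ ∈ F, ∀ v : Fin n → e, φ (fun i => (v i : T)) = 0)
    {σ : T ⧸ e →ₗ[ℝ] T} (hσ : e.mkQ ∘ₗ σ = LinearMap.id) (π : e →ₗ[ℝ] T ⧸ e) :
    π ∈ realTableau F e ↔ ∀ φ ∈ F, ∀ v : Fin n → e,
      φ.toMultilinearMap.linearDeriv (fun i => (v i : T)) (fun i => σ (π (v i))) = 0 := by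
  constructor
  · rintro ⟨P, rfl, h⟩ φ hφ v
    have h0 := (h φ hφ v).unique (hasDerivAt_multilinear_line φ.toMultilinearMap
      (fun i => (v i : T)) (fun i => P (v i)))
    refine Eq.trans ?_ h0.symm
    rw [MultilinearMap.linearDeriv_apply,
      MultilinearMap.linearDeriv_apply]
    refine Finset.sum_congr rfl fun i _ => ?_
    -- Two lifts of the same normal direction differ by a vector of e, which contributes nothing
    -- because φ vanishes on e.
    have hmem : σ (e.mkQ (P (v i))) - P (v i) ∈ e := by
      refine (Submodule.Quotient.mk_eq_zero e).1 ?_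
      rw [← e.mkQ_apply, map_sub, sub_eq_zero]
      exact LinearMap.congr_fun hσ _
    have h0 := hF φ hφ (Function.update v i ⟨_, hmem⟩)
    have hup : (fun j => ((Function.update v i ⟨_, hmem⟩ : Fin n → e) j : T)) =
        Function.update (fun j => (v j : T)) i (σ (e.mkQ (P (v i))) - P (v i)) := by
      funext j
      by_cases hj : j = i
      · subst hj; simp
      · simp [hj]
    rw [hup] at h0
    exact sub_eq_zero.1 ((φ.toMultilinearMap.map_update_sub _ _ _ _).symm.trans h0)
  · intro h
    refine ⟨σ ∘ₗ π, by rw [← LinearMap.comp_assoc, hσ, LinearMap.id_comp], fun φ hφ v => ?_⟩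
    have := hasDerivAt_multilinear_line φ.toMultilinearMap (fun i => (v i : T))
      (fun i => σ (π (v i)))
    rwa [h φ hφ v] at this

/-- Real and imaginary parts of an element of a complexification. -/
theorem exists_re_im {E : Type*} [AddCommGroup E] [Module ℝ E] :
    ∃ f g : (ℂ ⊗[ℝ] E) →ₗ[ℝ] E,
      ∀ x, x = (1 : ℂ) ⊗ₜ[ℝ] f x + Complex.I • ((1 : ℂ) ⊗ₜ[ℝ] g x) := by
  refine ⟨(TensorProduct.lid ℝ E).toLinearMap ∘ₗ Complex.reLm.rTensor E,
    (TensorProduct.lid ℝ E).toLinearMap ∘ₗ Complex.imLm.rTensor E, fun x => ?_⟩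
  induction x with
  | zero => simp
  | add x y hx hy =>
    rw [map_add, map_add, TensorProduct.tmul_add, TensorProduct.tmul_add, smul_add]
    nth_rw 1 [hx, hy]
    abel
  | tmul c v =>
    simp only [LinearMap.comp_apply, LinearMap.rTensor_tmul, LinearEquiv.coe_coe,
      TensorProduct.lid_tmul, Complex.reLm_coe, Complex.imLm_coe, TensorProduct.tmul_smul,
      TensorProduct.smul_tmul', ← TensorProduct.add_tmul]
    congr 1
    apply Complex.ext <;> simp

theorem exists_baseChange_add {E N : Type*} [AddCommGroup E] [Module ℝ E] [AddCommGroup N]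
    [Module ℝ N] (π : (ℂ ⊗[ℝ] E) →ₗ[ℂ] (ℂ ⊗[ℝ] N)) :
    ∃ π₁ π₂ : E →ₗ[ℝ] N, π = π₁.baseChange ℂ + Complex.I • π₂.baseChange ℂ := by
  obtain ⟨f, g, h⟩ := exists_re_im (E := N)
  refine ⟨f ∘ₗ π.restrictScalars ℝ ∘ₗ TensorProduct.mk ℝ ℂ E 1,
    g ∘ₗ π.restrictScalars ℝ ∘ₗ TensorProduct.mk ℝ ℂ E 1, ?_⟩
  refine LinearMap.ext fun x => ?_
  induction x with
  | zero => simp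
  | add x y hx hy => rw [map_add, map_add, hx, hy]
  | tmul c v =>
    have hc : c ⊗ₜ[ℝ] v = c • ((1 : ℂ) ⊗ₜ[ℝ] v) := by
      rw [TensorProduct.smul_tmul', smul_eq_mul, mul_one]
    rw [hc, map_smul, map_smul]
    exact congrArg _ (h _)

variable [FiniteDimensional ℝ T]

/-- Antisymmetry under a swap need only be checked on a real basis; with equal arguments the value
is its own negative. -/
theorem complexify_eq_zero_of_eq {n : ℕ} (φ : T [⋀^Fin n]→ₗ[ℝ] ℝ) (v : Fin n → ℂ ⊗[ℝ] T)
    (i j : Fin n) (hv : v i = v j) (hij : i ≠ j) : complexify φ v = 0 := by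
  have hswap : (complexify φ).domDomCongr (Equiv.swap i j) = -complexify φ := by
    refine Module.Basis.ext_multilinear
      (fun _ => (Module.finBasis ℝ T).baseChange ℂ) fun f => ?_
    simp only [MultilinearMap.domDomCongr_apply, neg_apply,
      Module.Basis.baseChange_apply]
    rw [complexify_one_tmul, complexify_one_tmul, ← Complex.ofReal_neg]
    exact congrArg _ (φ.map_swap (fun k => Module.finBasis ℝ T (f k)) hij)
  have h := congrArg (fun ψ : MultilinearMap ℂ (fun _ : Fin n => ℂ ⊗[ℝ] T) ℂ => ψ v) hswap
  simp only [MultilinearMap.domDomCongr_apply, neg_apply] at h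
  have hvs : (fun k => v (Equiv.swap i j k)) = v := by
    funext k
    rw [Equiv.swap_apply_def]
    split_ifs with h1 h2
    · rw [h1, hv]
    · rw [h2, hv]
    · rfl
  rw [hvs] at h
  exact self_eq_neg.1 h

/-- The complex extension of an alternating form, as an alternating form. -/
def complexifyAlt {n : ℕ} (φ : T [⋀^Fin n]→ₗ[ℝ] ℝ) : (ℂ ⊗[ℝ] T) [⋀^Fin n]→ₗ[ℂ] ℂ :=
  { complexify φ with map_eq_zero_of_eq' := complexify_eq_zero_of_eq φ }

theorem complexifyAlt_apply {n : ℕ} (φ : T [⋀^Fin n]→ₗ[ℝ] ℝ) (v : Fin n → ℂ ⊗[ℝ] T) :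
    complexifyAlt φ v = complexify φ v := rfl

/-- The form pulls back to a top-degree form on V_e, so its value on one real basis decides whether
it vanishes. -/
theorem complexify_baseChange_eq_zero {n : ℕ} {e : Submodule ℝ T}
    (b : Module.Basis (Fin n) ℝ e) {φ : T [⋀^Fin n]→ₗ[ℝ] ℝ}
    (hφ : ∀ v : Fin n → e, φ (fun i => (v i : T)) = 0) (x : Fin n → V e) :
    complexify φ (fun i => e.subtype.baseChange ℂ (x i)) = 0 := by
  have h : (complexifyAlt φ).compLinearMap (e.subtype.baseChange ℂ) = 0 := by
    refine (AlternatingMap.map_basis_eq_zero_iff (b.baseChange ℂ) _).1 ?_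
    rw [AlternatingMap.compLinearMap_apply, complexifyAlt_apply]
    have h1 : ∀ i, e.subtype.baseChange ℂ (b.baseChange ℂ i) = (1 : ℂ) ⊗ₜ[ℝ] (b i : T) :=
      fun i => by rw [Module.Basis.baseChange_apply, LinearMap.baseChange_tmul]; rfl
    simp only [h1]
    rw [complexify_one_tmul, hφ b, Complex.ofReal_zero]
  exact congrArg (fun ψ : V e [⋀^Fin n]→ₗ[ℂ] ℂ => ψ x) h

/-- The defining equations are real, so the real and imaginary parts of a complex solution are
solutions: the span of the real tableau is the full complex solution space. -/
theorem mem_tableau {n : ℕ} {F : Set (T [⋀^Fin n]→ₗ[ℝ] ℝ)} {e : Submodule ℝ T}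
    (hF : ∀ φ ∈ F, ∀ v : Fin n → e, φ (fun i => (v i : T)) = 0)
    {σ : T ⧸ e →ₗ[ℝ] T} (hσ : e.mkQ ∘ₗ σ = LinearMap.id) (π : V e →ₗ[ℂ] W e) :
    π ∈ tableau F e ↔ ∀ φ ∈ F, ∀ v : Fin n → e,
      (complexify φ).linearDeriv (fun i => (1 : ℂ) ⊗ₜ[ℝ] (v i : T))
        (fun i => σ.baseChange ℂ (π ((1 : ℂ) ⊗ₜ[ℝ] v i))) = 0 := by
  have hreal : ∀ (φ : T [⋀^Fin n]→ₗ[ℝ] ℝ) (v : Fin n → e) (π : e →ₗ[ℝ] T ⧸ e),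
      (complexify φ).linearDeriv (fun i => (1 : ℂ) ⊗ₜ[ℝ] (v i : T))
        (fun i => σ.baseChange ℂ (π.baseChange ℂ ((1 : ℂ) ⊗ₜ[ℝ] v i))) =
      ((φ.toMultilinearMap.linearDeriv (fun i => (v i : T)) (fun i => σ (π (v i))) : ℝ) : ℂ) := by
    intro φ v π
    rw [MultilinearMap.linearDeriv_apply, MultilinearMap.linearDeriv_apply, Complex.ofReal_sum]
    refine Finset.sum_congr rfl fun i _ => ?_
    refine Eq.trans (congrArg _ ?_) (complexify_one_tmul φ
      (Function.update (fun i => (v i : T)) i (σ (π (v i)))))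
    funext j
    by_cases hj : j = i
    · subst hj; simp
    · simp [hj]
  have hadd : ∀ (φ : T [⋀^Fin n]→ₗ[ℝ] ℝ) (v : Fin n → e) (c : ℂ) (π π' : V e →ₗ[ℂ] W e),
      (complexify φ).linearDeriv (fun i => (1 : ℂ) ⊗ₜ[ℝ] (v i : T))
        (fun i => σ.baseChange ℂ ((π + c • π') ((1 : ℂ) ⊗ₜ[ℝ] v i))) =
      (complexify φ).linearDeriv (fun i => (1 : ℂ) ⊗ₜ[ℝ] (v i : T))
        (fun i => σ.baseChange ℂ (π ((1 : ℂ) ⊗ₜ[ℝ] v i))) +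
      c * (complexify φ).linearDeriv (fun i => (1 : ℂ) ⊗ₜ[ℝ] (v i : T))
        (fun i => σ.baseChange ℂ (π' ((1 : ℂ) ⊗ₜ[ℝ] v i))) := by
    intro φ v c π π'
    rw [← smul_eq_mul, ← map_smul, ← map_add]
    congr 1
    funext i
    simp
  constructor
  · intro h φ hφ v
    induction h using Submodule.span_induction with
    | mem π hπ =>
      obtain ⟨π, hπ, rfl⟩ := hπ
      rw [hreal, (mem_realTableau hF hσ π).1 hπ φ hφ v, Complex.ofReal_zero]
    | zero => simp [MultilinearMap.linearDeriv_apply]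
    | add π π' _ _ h h' =>
      have := hadd φ v 1 π π'
      rw [one_smul] at this
      rw [this, h, h', mul_zero, add_zero]
    | smul c π _ h =>
      have := hadd φ v c 0 π
      rw [zero_add] at this
      rw [this, h]
      simp [MultilinearMap.linearDeriv_apply]
  · intro h
    obtain ⟨π₁, π₂, rfl⟩ := exists_baseChange_add π
    have key : ∀ φ ∈ F, ∀ v : Fin n → e,
        φ.toMultilinearMap.linearDeriv (fun i => (v i : T)) (fun i => σ (π₁ (v i))) = 0 ∧
        φ.toMultilinearMap.linearDeriv (fun i => (v i : T)) (fun i => σ (π₂ (v i))) = 0 := by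
      intro φ hφ v
      have h0 := h φ hφ v
      rw [hadd, hreal, hreal] at h0
      exact ⟨by simpa using congrArg Complex.re h0, by simpa using congrArg Complex.im h0⟩
    refine Submodule.add_mem _ (Submodule.subset_span ⟨π₁, ?_, rfl⟩)
      (Submodule.smul_mem _ _ (Submodule.subset_span ⟨π₂, ?_, rfl⟩))
    · exact (mem_realTableau hF hσ π₁).2 fun φ hφ v => (key φ hφ v).1
    · exact (mem_realTableau hF hσ π₂).2 fun φ hφ v => (key φ hφ v).2

end Pointwise

/-! ### Polar spaces and rank-one elements of the tableau -/

section Pointwise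

/-- A basis all of whose vectors but one lie in the kernel of a given nonzero covector. -/
theorem exists_basis_adapted_to_ker {E : Type*} [AddCommGroup E] [Module ℂ E] {n : ℕ}
    (c : Module.Basis (Fin n) ℂ E) {ξ : Module.Dual ℂ E} (hξ : ξ ≠ 0) :
    ∃ (x : Module.Basis (Fin n) ℂ E) (i : Fin n), ∀ j, j ≠ i → ξ (x j) = 0 := by
  obtain ⟨i, hi⟩ : ∃ i, ξ (c i) ≠ 0 := by
    by_contra! h
    exact hξ (c.ext h)
  -- This transvection replaces c_j, for j ≠ i, by c_j − (ξ(c_j)/ξ(c_i)) c_i, which lies in the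
  -- kernel of ξ, and fixes c_i.
  have hf : (c.coord i - (ξ (c i))⁻¹ • ξ) (c i) = 0 := by
    simp [hi]
  refine ⟨c.map (LinearEquiv.transvection hf), i, fun j hj => ?_⟩
  rw [Module.Basis.map_apply, LinearEquiv.transvection.apply]
  simp [Finsupp.single_eq_of_ne hj.symm]
  field_simp
  ring

/-- Adding multiples of one vector to the arguments of an alternating form is an affine
operation. -/
theorem alternating_add_smul {E : Type*} [AddCommGroup E] [Module ℂ E] {n : ℕ}
    (φ : E [⋀^Fin n]→ₗ[ℂ] ℂ) (x : Fin n → E) (c : Fin n → ℂ) (h : E) :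
    φ (fun i => x i + c i • h) =
      φ x + φ.toMultilinearMap.linearDeriv x (fun i => c i • h) := by
  have hexp := φ.toMultilinearMap.map_add_eq_map_add_linearDeriv_add x (fun i => c i • h)
  refine hexp.trans ?_
  rw [Finset.sum_eq_zero, add_zero]
  · rfl
  -- Each term of order at least two has h in two slots, up to scalars, so it vanishes by
  -- alternation.
  · intro s hs
    obtain ⟨i, hi, j, hj, hij⟩ := Finset.one_lt_card.1 (Finset.mem_filter.1 hs).2
    have h1 := φ.toMultilinearMap.map_piecewise_smul c (s.piecewise (fun _ => h) x) s
    have h2 : φ (s.piecewise (fun _ => h) x) = 0 :=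
      φ.map_eq_zero_of_eq _ (by simp [hi, hj]) hij
    have h3 : s.piecewise (fun k => c k • s.piecewise (fun _ => h) x k)
        (s.piecewise (fun _ => h) x) = s.piecewise (fun i => c i • h) x := by
      funext k
      by_cases hk : k ∈ s <;> simp [hk]
    rw [h3] at h1
    exact h1.trans (by rw [AlternatingMap.coe_multilinearMap, h2, smul_zero])

variable {T : Type*} [AddCommGroup T] [Module ℝ T] [FiniteDimensional ℝ T] {n : ℕ}
  {F : Set (T [⋀^Fin n]→ₗ[ℝ] ℝ)} {e : Submodule ℝ T}

/-- Membership of an element of rank one in the tableau, in terms of the pull-backs of the forms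
to `V_e` under the corresponding perturbation of the inclusion. -/
theorem smulRight_mem_tableau (hF : ∀ φ ∈ F, ∀ v : Fin n → e, φ (fun i => (v i : T)) = 0)
    (b : Module.Basis (Fin n) ℝ e) (ξ : Module.Dual ℂ (V e)) (h : ℂ ⊗[ℝ] T) :
    ξ.smulRight (e.mkQ.baseChange ℂ h) ∈ tableau F e ↔
      ∀ φ ∈ F, (complexifyAlt φ).compLinearMap
        (e.subtype.baseChange ℂ + ξ.smulRight h) = 0 := by
  obtain ⟨σ, ρ, hσ, hρ, hsplit⟩ := exists_splitting e
  have hψ : ∀ φ ∈ F, ∀ x : Fin n → V e, (complexifyAlt φ).compLinearMap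
      (e.subtype.baseChange ℂ + ξ.smulRight h) x =
      (complexify φ).linearDeriv (fun i => e.subtype.baseChange ℂ (x i))
        (fun i => ξ (x i) • h) := by
    intro φ hφ x
    have h1 := alternating_add_smul (complexifyAlt φ) (fun i => e.subtype.baseChange ℂ (x i))
      (fun i => ξ (x i)) h
    rw [complexifyAlt_apply φ fun i => e.subtype.baseChange ℂ (x i),
      complexify_baseChange_eq_zero b (hF φ hφ), zero_add] at h1
    exact h1
  have hh : h = e.subtype.baseChange ℂ (ρ.baseChange ℂ h) +
      σ.baseChange ℂ (e.mkQ.baseChange ℂ h) := by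
    have := congrArg (fun f : T →ₗ[ℝ] T => f.baseChange ℂ h) hsplit
    simp only [LinearMap.baseChange_add, LinearMap.baseChange_comp, LinearMap.baseChange_id,
      LinearMap.add_apply, LinearMap.comp_apply, LinearMap.id_apply] at this
    exact this.symm
  -- The component of h along e may be dropped, since the forms vanish on e; only the class of h in
  -- W_e matters.
  have hlin : ∀ φ ∈ F, ∀ x : Fin n → V e,
      (complexify φ).linearDeriv (fun i => e.subtype.baseChange ℂ (x i))
        (fun i => ξ (x i) • h) =
      (complexify φ).linearDeriv (fun i => e.subtype.baseChange ℂ (x i))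
        (fun i => σ.baseChange ℂ (ξ.smulRight (e.mkQ.baseChange ℂ h) (x i))) := by
    intro φ hφ x
    rw [MultilinearMap.linearDeriv_apply, MultilinearMap.linearDeriv_apply]
    refine Finset.sum_congr rfl fun i _ => ?_
    rw [LinearMap.smulRight_apply, map_smul, MultilinearMap.map_update_smul,
      MultilinearMap.map_update_smul]
    congr 1
    conv_lhs => rw [hh]
    rw [MultilinearMap.map_update_add]
    refine (congrArg₂ _ ?_ rfl).trans (zero_add _)
    rw [← complexify_baseChange_eq_zero b (hF φ hφ) (Function.update x i (ρ.baseChange ℂ h))]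
    congr 1
    funext j
    by_cases hj : j = i
    · subst hj; simp
    · simp [hj]
  rw [mem_tableau hF hσ]
  have hreal : ∀ v : Fin n → e, (fun i => (1 : ℂ) ⊗ₜ[ℝ] (v i : T)) =
      fun i => e.subtype.baseChange ℂ ((1 : ℂ) ⊗ₜ[ℝ] v i) := fun v => rfl
  constructor
  · intro H φ hφ
    refine (AlternatingMap.map_basis_eq_zero_iff (b.baseChange ℂ) _).1 ?_
    rw [hψ φ hφ, hlin φ hφ]
    simp only [Module.Basis.baseChange_apply]
    exact H φ hφ b
  · intro H φ hφ v
    rw [hreal, ← hlin φ hφ, ← hψ φ hφ, H φ hφ]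
    rfl

/-- The polar space of a hyperplane consists of the vectors that together with the hyperplane give
rise to an element of rank one of the tableau. -/
theorem mem_polarSpace (hF : ∀ φ ∈ F, ∀ v : Fin n → e, φ (fun i => (v i : T)) = 0)
    (b : Module.Basis (Fin n) ℝ e) {ξ : Module.Dual ℂ (V e)} (hξ : ξ ≠ 0) (h : ℂ ⊗[ℝ] T) :
    h ∈ polarSpace F ((LinearMap.ker ξ).map (e.subtype.baseChange ℂ)) ↔
      ξ.smulRight (e.mkQ.baseChange ℂ h) ∈ tableau F e := by
  have hupd : ∀ φ ∈ F, ∀ (x : Fin n → V e) (i : Fin n), (∀ j, j ≠ i → ξ (x j) = 0) →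
      (complexifyAlt φ).compLinearMap (e.subtype.baseChange ℂ + ξ.smulRight h) x =
        ξ (x i) * complexify φ
          (Function.update (fun j => e.subtype.baseChange ℂ (x j)) i h) := by
    intro φ hφ x i hx
    have h1 : (fun j => (e.subtype.baseChange ℂ + ξ.smulRight h) (x j)) =
        Function.update (fun j => e.subtype.baseChange ℂ (x j)) i
          (e.subtype.baseChange ℂ (x i) + ξ (x i) • h) := by
      funext j
      by_cases hj : j = i
      · subst hj; simp
      · simp [hj, hx j hj]
    rw [AlternatingMap.compLinearMap_apply, complexifyAlt_apply]
    refine (congrArg _ h1).trans ?_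
    rw [MultilinearMap.map_update_add, MultilinearMap.map_update_smul, smul_eq_mul,
      Function.update_eq_self, complexify_baseChange_eq_zero b (hF φ hφ), zero_add]
  rw [smulRight_mem_tableau hF b]
  constructor
  · intro H φ hφ
    obtain ⟨x, i, hx⟩ := exists_basis_adapted_to_ker (b.baseChange ℂ) hξ
    refine (AlternatingMap.map_basis_eq_zero_iff x _).1 ?_
    rw [hupd φ hφ x i hx]
    -- The polar equations require all slots of `a` to lie in the hyperplane. Slot i is overwritten
    -- by h anyway, so 0 serves as a filler.
    have h1 := H φ hφ (Function.update (fun j => e.subtype.baseChange ℂ (x j)) i 0) (fun j => by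
      by_cases hj : j = i
      · subst hj; simp
      · rw [Function.update_of_ne hj]
        exact ⟨x j, hx j hj, rfl⟩) i
    rw [Function.update_idem] at h1
    rw [h1, mul_zero]
  · intro H φ hφ a ha i
    choose k hk hka using ha
    -- Filling the free slot with a vector off the hyperplane turns the vanishing pull-back into
    -- ξ(v) times the polar equation.
    obtain ⟨v, hv⟩ : ∃ v, ξ v ≠ 0 := by
      by_contra! h0
      exact hξ (LinearMap.ext h0)
    have h1 := hupd φ hφ (Function.update k i v) i fun j hj => by
      rw [Function.update_of_ne hj]; exact hk j
    have h2 : Function.update (fun j => e.subtype.baseChange ℂ (Function.update k i v j)) i h =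
        Function.update a i h := by
      funext j
      by_cases hj : j = i
      · subst hj; simp
      · simp [hj, hka]
    rw [H φ hφ, h2, Function.update_self] at h1
    exact (mul_eq_zero.1 h1.symm).resolve_left hv

/-- A covector is characteristic if and only if the tableau has an element of rank one over it. -/
theorem mem_charVariety (hF : ∀ φ ∈ F, ∀ v : Fin n → e, φ (fun i => (v i : T)) = 0)
    (b : Module.Basis (Fin n) ℝ e) (ξ : Module.Dual ℂ (V e)) :
    ξ ∈ charVariety F e ↔ ξ ≠ 0 ∧ ∃ z : W e, z ≠ 0 ∧ ξ.smulRight z ∈ tableau F e := by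
  refine and_congr_right fun hξ => ?_
  obtain ⟨σ, ρ, hσ, hρ, hsplit⟩ := exists_splitting e
  set ι := e.subtype.baseChange ℂ with hι
  set q := e.mkQ.baseChange ℂ with hq
  have hρι : ∀ x, ρ.baseChange ℂ (ι x) = x := fun x => by
    have := congrArg (fun f : e →ₗ[ℝ] e => f.baseChange ℂ x) hρ
    simp only [LinearMap.baseChange_comp, LinearMap.baseChange_id] at this
    exact this
  have hqσ : ∀ z, q (σ.baseChange ℂ z) = z := fun z => by
    have := congrArg (fun f : (T ⧸ e) →ₗ[ℝ] (T ⧸ e) => f.baseChange ℂ z) hσ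
    simp only [LinearMap.baseChange_comp, LinearMap.baseChange_id] at this
    exact this
  have hqι : ∀ x, q (ι x) = 0 := fun x => by
    have h0 : e.mkQ ∘ₗ e.subtype = 0 := by ext x; simp
    have := congrArg (fun f : e →ₗ[ℝ] (T ⧸ e) => f.baseChange ℂ x) h0
    simp only [LinearMap.baseChange_comp, LinearMap.baseChange_zero] at this
    exact this
  have hdec : ∀ h, ι (ρ.baseChange ℂ h) + σ.baseChange ℂ (q h) = h := fun h => by
    have := congrArg (fun f : T →ₗ[ℝ] T => f.baseChange ℂ h) hsplit
    simp only [LinearMap.baseChange_add, LinearMap.baseChange_comp, LinearMap.baseChange_id] at this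
    exact this
  have hinj : Function.Injective ι := Function.LeftInverse.injective hρι
  set H := polarSpace F ((LinearMap.ker ξ).map ι) with hH
  have hle : LinearMap.range ι ≤ H := by
    rintro _ ⟨x, rfl⟩
    rw [hH, mem_polarSpace hF b hξ, ← hq, hqι, LinearMap.smulRight_zero]
    exact Submodule.zero_mem _
  have hrange : Module.finrank ℂ (LinearMap.range ι) = Module.finrank ℂ (V e) :=
    LinearMap.finrank_range_of_inj hinj
  have hker : Module.finrank ℂ ((LinearMap.ker ξ).map ι) + 1 = Module.finrank ℂ (V e) := by
    rw [LinearEquiv.finrank_eq (Submodule.equivMapOfInjective ι hinj _).symm]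
    exact Module.Dual.finrank_ker_add_one_of_ne_zero hξ
  -- The hyperplane has dimension dim V_e − 1, so the polar rank is dim H − dim V_e, the excess of H
  -- over the copy of V_e that it contains.
  have hrank : 0 < polarRank F ((LinearMap.ker ξ).map ι) ↔
      Module.finrank ℂ (LinearMap.range ι) < Module.finrank ℂ H := by
    rw [polarRank, ← hH, hrange]
    omega
  rw [hrank]
  constructor
  · intro hlt
    -- A polar vector outside V_e has a nonzero class in W_e, and this class is the required z.
    obtain ⟨h, hh, hh'⟩ := SetLike.exists_of_lt
      (lt_of_le_of_ne hle fun heq => by rw [← heq] at hlt; exact lt_irrefl _ hlt)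
    refine ⟨q h, fun h0 => hh' ⟨ρ.baseChange ℂ h, ?_⟩, (mem_polarSpace hF b hξ h).1 hh⟩
    have := hdec h
    rwa [h0, map_zero, add_zero] at this
  · rintro ⟨z, hz, hA⟩
    refine Submodule.finrank_lt_finrank_of_lt (lt_of_le_of_ne hle fun heq => hz ?_)
    have hmem : σ.baseChange ℂ z ∈ H := (mem_polarSpace hF b hξ _).2 (by rwa [← hq, hqσ])
    rw [← heq] at hmem
    obtain ⟨x, hx⟩ := hmem
    rw [← hqσ z, ← hx, hqι]

end Pointwise

end EDS

end

/-! ### The theorem for exterior differential systems -/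

theorem mainTheorem10 {m n r : ℕ} {M : Type*} [TopologicalSpace M]
    [ChartedSpace (EuclideanSpace ℝ (Fin m)) M] [IsManifold (𝓡 m) ∞ M]
    (I : EDS.ExteriorDifferentialSystem m M) (x : M)
    (e : Submodule ℝ (TangentSpace (𝓡 m) x)) (he : e ∈ I.ordinaryElements n x)
    (hinv : I.IsInvolutiveAt n x e)
    (ℓ L : ℕ) (u : Module.Basis (Fin n) ℂ (EDS.V e))
    (hadapted : EDS.IsAdapted (I.charVariety n x e) ℓ L u)
    (hgeneric : EDS.IsGeneric (I.tableau n x e) u)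
    (w : Module.Basis (Fin r) ℂ (EDS.W e)) (B : Fin r → Fin n → Fin n → Fin r → ℂ)
    (hB : EDS.IsSymbolNormalForm (I.tableau n x e) u w B)
    (v : EDS.V e) :
    List.TFAE [
      v ∈ I.X1 n x e,
      ∀ i : Fin n, (i : ℕ) < L → u.coord i v = 0,
      ∀ φ ∈ EDS.coframeSpan u 0 ℓ,
        ∃ h : ∀ z ∈ EDS.guilleminSpace (I.tableau n x e) u ℓ φ,
            EDS.symbolEnd (I.tableau n x e) u w B φ v z ∈
              EDS.guilleminSpace (I.tableau n x e) u ℓ φ,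
          IsNilpotent ((EDS.symbolEnd (I.tableau n x e) u w B φ v).restrict h)] := by
  have hF : ∀ φ ∈ I.formsAt n x, ∀ y : Fin n → e,
      φ (fun i => (y i : TangentSpace (𝓡 m) x)) = 0 := by
    rintro _ ⟨φ, hφ, rfl⟩ y
    exact he.2.1 n φ hφ _ fun i => (y i).2
  -- Genericity of u is what turns involutivity into Cartan's equality in this very frame.
  exact EDS.tfae_mem_dualCoannihilator_span (hinv u hgeneric) hB
    (EDS.mem_charVariety hF (Module.finBasisOfFinrankEq ℝ e he.1)) hadapted v
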